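/- A simple polygon is identified with the closed region it bounds. Two vertices of a simple polygon see each other if they span an edge of the polygon or an interior diagonal (the open segment between them lies in the interior of the polygon). A triangulation of a simple polygon is a maximal non-crossing straight-line graph on its vertices consisting of edges and interior diagonals of the polygon. A flip removes one edge of a triangulation and adds a different one such that the result is again a triangulation. A flip sequence from $T$ to $T'$ is a sequence of triangulations starting with $T$ and ending with $T'$ in which consecutive ones differ by a flip; its length is the number of flips. Let $n\ge 2$. A double chain $D$ consists of an upper chain $\langle u_1,\dots,u_n\rangle$ and a lower chain $\langle l_1,\dots,l_n\rangle$ of points in the plane, both numbered from left to right, such that $P_D=\langle l_1,\dots,l_n,u_n,\dots,u_1\rangle$ is a simple polygon (in counterclockwise order), each vertex of one chain sees each vertex of the other chain in $P_D$, and any three vertices of one chain together with one vertex of the other chain form a non-convex quadrilateral (the four points are not in convex position). The upper (respectively lower) extreme triangulation of $P_D$ is the triangulation of $P_D$ in which $u_1$ (respectively $l_1$) has maximum degree among all triangulations of $P_D$. Let $W_1$ be the wedge of all points on or below the line through $u_1,u_2$ and on or above the line through $l_1,l_2$, and let $W_n$ be the wedge of all points on or below the line through $u_{n-1},u_n$ and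 on or above the line through $l_{n-1},l_n$ (these lines being directed from left to right, i.e. by increasing index). The hourglass of $D$ is $W_1\cup W_n$. Lemma. Let $P$ be a simple polygon that contains $P_D$ and has $\langle u_n,\dots,u_1,l_1,\dots,l_n\rangle$ as a consecutive part of its boundary. Let $T_1$ and $T_2$ be triangulations of $P$ that contain the upper and the lower extreme triangulation of $P_D$ as a sub-triangulation, respectively. Let $\sigma$ be a flip sequence of triangulations of $P$ from $T_1$ to $T_2$ such that no triangulation in $\sigma$ (including $T_1$ and $T_2$) contains a triangle with one vertex on the upper chain, one vertex on the lower chain, and the third vertex in the interior of the hourglass. Then $|\sigma|\ge (n-1)^2$. -/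

import Mathlib

/-! The plane is `ℂ`. A polygon with `N` vertices is given by its cyclic vertex sequence
`v : Fin N → ℂ`; the successor of the index `i` is `finRotate N i`. -/

noncomputable section

namespace FlipDist

/-- The boundary: the union of the closed segments between cyclically consecutive vertices. -/
def polygonBoundary {N : ℕ} (v : Fin N → ℂ) : Set ℂ :=
  ⋃ i : Fin N, segment ℝ (v i) (v (finRotate N i))

/-- The winding number of the closed polygonal curve `v` around a point `x` off the boundary: the
sum, over the edges, of the signed angles in `(-π, π)` under which they are seen from `x`,
divided by `2π`. -/
def windingNumber {N : ℕ} (v : Fin N → ℂ) (x : ℂ) : ℝ :=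
  (∑ i : Fin N, Complex.arg ((v (finRotate N i) - x) / (v i - x))) / (2 * Real.pi)

/-- The interior: the points off the boundary around which the boundary curve winds. -/
def polygonInterior {N : ℕ} (v : Fin N → ℂ) : Set ℂ :=
  {x | x ∉ polygonBoundary v ∧ windingNumber v x ≠ 0}

/-- The closed region bounded by the polygon. -/
def polygonRegion {N : ℕ} (v : Fin N → ℂ) : Set ℂ :=
  polygonBoundary v ∪ polygonInterior v

/-- `v` lists the vertices of a simple polygon in counterclockwise order. -/
structure IsSimplePolygon {N : ℕ} (v : Fin N → ℂ) : Prop where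
  three_le : 3 ≤ N
  injective : Function.Injective v
  /-- Distinct edges meet at most in common endpoints. -/
  edges_inter : ∀ i j : Fin N, i ≠ j →
    segment ℝ (v i) (v (finRotate N i)) ∩ segment ℝ (v j) (v (finRotate N j)) ⊆
      {v i, v (finRotate N i)} ∩ {v j, v (finRotate N j)}
  /-- The boundary is traversed counterclockwise: it winds `+1` times around interior points. -/
  counterclockwise : ∀ x ∈ polygonInterior v, windingNumber v x = 1

/-- Two vertices of a polygon see each other: they span an edge of the polygon, or an interior
diagonal, i.e. the open segment between them lies in the interior of the polygon. -/
def visibilityGraph {N : ℕ} (v : Fin N → ℂ) : SimpleGraph ℂ where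
  Adj a b := a ≠ b ∧ ((∃ i : Fin N, s(a, b) = s(v i, v (finRotate N i))) ∨
    (a ∈ Set.range v ∧ b ∈ Set.range v ∧ openSegment ℝ a b ⊆ polygonInterior v))
  symm := ⟨by
    rintro a b ⟨hab, h⟩
    refine ⟨hab.symm, ?_⟩
    rcases h with ⟨i, hi⟩ | ⟨ha, hb, h⟩
    · exact Or.inl ⟨i, by rw [Sym2.eq_swap, hi]⟩
    · exact Or.inr ⟨hb, ha, by rwa [openSegment_symm]⟩⟩
  loopless := ⟨fun _ h => h.1 rfl⟩

/-- A straight-line graph without crossings: the relative interiors of distinct edges are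
disjoint. -/
def IsNonCrossing (G : SimpleGraph ℂ) : Prop :=
  ∀ a b c d : ℂ, G.Adj a b → G.Adj c d → s(a, b) ≠ s(c, d) →
    Disjoint (openSegment ℝ a b) (openSegment ℝ c d)

/-- A triangulation of a simple polygon: a maximal non-crossing straight-line graph whose edges
are edges and interior diagonals of the polygon. (By maximality it contains all edges of the
polygon.) -/
def IsTriangulation {N : ℕ} (v : Fin N → ℂ) (T : SimpleGraph ℂ) : Prop :=
  Maximal (fun G : SimpleGraph ℂ => G ≤ visibilityGraph v ∧ IsNonCrossing G) T

/-- `T'` arises from `T` by removing one edge and adding a different one. Between triangulations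
of the same polygon this is a flip. -/
def IsFlip (T T' : SimpleGraph ℂ) : Prop :=
  ∃ d ∈ T.edgeSet, ∃ d' ∉ T.edgeSet, T'.edgeSet = insert d' (T.edgeSet \ {d})

/-- `σ 0, …, σ m` is a flip sequence, with `m` flips, of triangulations of the polygon `v`. -/
def IsFlipSequence {N : ℕ} (v : Fin N → ℂ) (m : ℕ) (σ : ℕ → SimpleGraph ℂ) : Prop :=
  (∀ t ≤ m, IsTriangulation v (σ t)) ∧ ∀ t < m, IsFlip (σ t) (σ (t + 1))

/-- The closed polygonal vertex sequence `⟨u_n, …, u_1, l_1, …, l_n⟩` (which, read cyclically, is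
also `⟨l_1, …, l_n, u_n, …, u_1⟩`). Only the values of `u` and `l` at `1, …, n` matter. -/
def chainPolygon (n : ℕ) (u l : ℕ → ℂ) : Fin (2 * n) → ℂ := fun k =>
  if k.val < n then u (n - k.val) else l (k.val - n + 1)

/-- A double chain with upper chain `u 1, …, u n` and lower chain `l 1, …, l n`. That the chains
are the upper and the lower one, both numbered from left to right, means (up to a rotation of the
plane) that `⟨l_1, …, l_n, u_n, …, u_1⟩` is a counterclockwise simple polygon. A quadrilateral is
non-convex if its four vertices are not in convex position. -/
structure IsDoubleChain (n : ℕ) (u l : ℕ → ℂ) : Prop where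
  two_le : 2 ≤ n
  simple : IsSimplePolygon (chainPolygon n u l)
  sees : ∀ i ∈ Set.Icc 1 n, ∀ j ∈ Set.Icc 1 n,
    (visibilityGraph (chainPolygon n u l)).Adj (u i) (l j)
  nonconvex_upper : ∀ i j k m : ℕ, 1 ≤ i → i < j → j < k → k ≤ n → 1 ≤ m → m ≤ n →
    ¬ ConvexIndependent ℝ ![u i, u j, u k, l m]
  nonconvex_lower : ∀ i j k m : ℕ, 1 ≤ i → i < j → j < k → k ≤ n → 1 ≤ m → m ≤ n →
    ¬ ConvexIndependent ℝ ![l i, l j, l k, u m]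

/-- `T` is a triangulation of the polygon `v` in which the vertex `a` has the largest degree that
it attains in any triangulation of `v`. -/
def IsMaxDegreeTriangulation {N : ℕ} (v : Fin N → ℂ) (a : ℂ) (T : SimpleGraph ℂ) : Prop :=
  IsTriangulation v T ∧
    ∀ T' : SimpleGraph ℂ, IsTriangulation v T' →
      (T'.neighborSet a).ncard ≤ (T.neighborSet a).ncard

/-- The upper extreme triangulation: `u_1` has maximum degree. -/
def IsUpperExtreme (n : ℕ) (u l : ℕ → ℂ) (T : SimpleGraph ℂ) : Prop :=
  IsMaxDegreeTriangulation (chainPolygon n u l) (u 1) T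

/-- The lower extreme triangulation: `l_1` has maximum degree. -/
def IsLowerExtreme (n : ℕ) (u l : ℕ → ℂ) (T : SimpleGraph ℂ) : Prop :=
  IsMaxDegreeTriangulation (chainPolygon n u l) (l 1) T

/-- Twice the signed area of the triangle `a b c`: positive (negative) iff `c` lies strictly to
the left (right) of the directed line from `a` to `b`. -/
def orient (a b c : ℂ) : ℝ :=
  (b.re - a.re) * (c.im - a.im) - (b.im - a.im) * (c.re - a.re)

/-- The closed wedge bounded by the lines through `a b` and through `c d`, consisting of the
points that are not to the left of `a → b` and not to the right of `c → d`. -/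
def wedge (a b c d : ℂ) : Set ℂ :=
  {x | orient a b x ≤ 0 ∧ 0 ≤ orient c d x}

/-- The hourglass `W_1 ∪ W_n` of a double chain. `W_1` consists of the points below the line
through `u_1 u_2` and above the line through `l_1 l_2` (directed from left to right); this is the
one of the wedges defined by these lines whose interior contains the points between `u_1` and
`l_1`. `W_n` is the analogous wedge for `u_{n-1} u_n` and `l_{n-1} l_n`. -/
def hourglass (n : ℕ) (u l : ℕ → ℂ) : Set ℂ :=
  wedge (u 1) (u 2) (l 1) (l 2) ∪ wedge (u (n - 1)) (u n) (l (n - 1)) (l n)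

/-- `T` contains a triangle with one vertex on the upper chain, one on the lower chain and the
third in the interior of the hourglass. -/
def HasHourglassTriangle (n : ℕ) (u l : ℕ → ℂ) (T : SimpleGraph ℂ) : Prop :=
  ∃ i ∈ Set.Icc 1 n, ∃ j ∈ Set.Icc 1 n, ∃ w ∈ interior (hourglass n u l),
    T.Adj (u i) (l j) ∧ T.Adj (u i) w ∧ T.Adj (l j) w

end FlipDist

end

/-!
For a triangulation `T` of `P`, consider the positions `(a, b)` for which `u a, l b` is an edge of
`T`. Since `u 1, l 1` is an edge of `P`, the position `(1, 1)` is among them. Since `T` is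
non-crossing, the positions form a chain in the product order. If `u a, l b` is an edge with
`a, b < n`, then the triangle of `T` to its right has the third vertex `u (a + 1)` or `l (b + 1)`,
because any other vertex visible from both `u a` and `l b` on this side lies in the interior of the
wedge at `u n, l n` of the hourglass (`IsBoundaryChain.adj_succ_or_adj_succ`). So the positions
form a lattice path from `(1, 1)` that goes by unit steps until one of the chains is used up
(`IsStaircase`).

Count the unit cells of `[1, n] × [1, n]` that lie below this path. For a triangulation that
contains the upper extreme triangulation the path starts with `(1, 1), …, (1, n)`, and the count is
`(n - 1) ^ 2`; for one that contains the lower extreme triangulation it is `0`. A flip exchanges at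
most one position of the path, and if the cell `(i, j)` changes sides, then the position that is
removed has the second coordinate `j + 1` and the one that is added has the first coordinate
`i + 1`. Hence a flip changes the count by at most one (`IsStaircase.card_cells_le`).

The geometric input is of three kinds.

* The winding number is locally constant off the boundary and jumps by one across an edge. So the
  interior of a counterclockwise polygon lies to the left of its edges, and points that are joined
  by a segment off the boundary are on the same side (`IsSimplePolygon.eventually_sides`,
  `mem_polygonInterior_of_segment`).
* Every vertex of a chain lies to the left of every edge of the opposite chain
  (`IsCyclicDoubleChain.orient_succ_pos`). In a triangle formed by an edge and an opposite vertex
  that violates this, the boundary enters at an end of the edge and can leave only through the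
  opposite vertex; so the triangle contains the neighbor of this vertex and with it a smaller
  triangle of the same kind. It follows that each chain is seen in angular order, that edges between
  the chains cross as expected, and that the triangles formed by an edge and an opposite vertex are
  free of other vertices.
* If `a b` is an edge of a triangulation and `q` is the neighbor of `a` that follows `b` in angular
  order, then `a b q` is an empty triangle of the triangulation
  (`IsTriangulation.exists_triangle`).
-/

namespace FlipDist

open Set Filter Topology

/-! ### Orientations, segments and triangles -/

lemma orient_rotate (a b c : ℂ) : orient b c a = orient a b c := by
  simp only [orient]; ring

lemma orient_swap (a b c : ℂ) : orient b a c = -orient a b c := by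
  simp only [orient]; ring

lemma orient_swap_right (a b c : ℂ) : orient a c b = -orient a b c := by
  simp only [orient]; ring

@[simp] lemma orient_self_left (a b : ℂ) : orient a b a = 0 := by
  simp only [orient]; ring

@[simp] lemma orient_self_right (a b : ℂ) : orient a b b = 0 := by
  simp only [orient]; ring

@[simp] lemma orient_self (a b : ℂ) : orient a a b = 0 := by
  simp only [orient]; ring

lemma orient_lineMap (p q a b : ℂ) (t : ℝ) :
    orient p q (AffineMap.lineMap a b t) = (1 - t) * orient p q a + t * orient p q b := by
  simp only [orient, AffineMap.lineMap_apply, vsub_eq_sub, vadd_eq_add, Complex.add_re,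
    Complex.add_im, Complex.sub_re, Complex.sub_im, Complex.real_smul, Complex.mul_re,
    Complex.mul_im, Complex.ofReal_re, Complex.ofReal_im]
  ring

@[fun_prop]
lemma continuous_orient (p q : ℂ) : Continuous (orient p q) := by
  unfold orient
  exact (continuous_const.mul (Complex.continuous_im.sub continuous_const)).sub
    (continuous_const.mul (Complex.continuous_re.sub continuous_const))

lemma mem_segment_lineMap {a b x : ℂ} :
    x ∈ segment ℝ a b ↔ ∃ t : ℝ, 0 ≤ t ∧ t ≤ 1 ∧ AffineMap.lineMap a b t = x := by
  rw [segment_eq_image_lineMap]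
  constructor
  · rintro ⟨t, ⟨h0, h1⟩, rfl⟩; exact ⟨t, h0, h1, rfl⟩
  · rintro ⟨t, h0, h1, rfl⟩; exact ⟨t, ⟨h0, h1⟩, rfl⟩

lemma mem_openSegment_lineMap {a b x : ℂ} :
    x ∈ openSegment ℝ a b ↔ ∃ t : ℝ, 0 < t ∧ t < 1 ∧ AffineMap.lineMap a b t = x := by
  rw [openSegment_eq_image_lineMap]
  constructor
  · rintro ⟨t, ⟨h0, h1⟩, rfl⟩; exact ⟨t, h0, h1, rfl⟩
  · rintro ⟨t, h0, h1, rfl⟩; exact ⟨t, ⟨h0, h1⟩, rfl⟩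

lemma orient_nonneg_of_mem_segment {p q a b x : ℂ} (hx : x ∈ segment ℝ a b)
    (ha : 0 ≤ orient p q a) (hb : 0 ≤ orient p q b) : 0 ≤ orient p q x := by
  obtain ⟨t, h0, h1, rfl⟩ := mem_segment_lineMap.1 hx
  rw [orient_lineMap]
  have := mul_nonneg (sub_nonneg.2 h1) ha
  have := mul_nonneg h0 hb
  linarith

lemma orient_pos_of_mem_openSegment {p q a b x : ℂ} (hx : x ∈ openSegment ℝ a b)
    (ha : 0 < orient p q a) (hb : 0 ≤ orient p q b) : 0 < orient p q x := by
  obtain ⟨t, h0, h1, rfl⟩ := mem_openSegment_lineMap.1 hx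
  rw [orient_lineMap]
  have := mul_pos (sub_pos.2 h1) ha
  have := mul_nonneg h0.le hb
  linarith

lemma orient_pos_of_mem_openSegment' {p q a b x : ℂ} (hx : x ∈ openSegment ℝ a b)
    (ha : 0 ≤ orient p q a) (hb : 0 < orient p q b) : 0 < orient p q x :=
  orient_pos_of_mem_openSegment (by rwa [openSegment_symm]) hb ha

lemma orient_pos_of_mem_segment {p q a b x : ℂ} (hx : x ∈ segment ℝ a b)
    (ha : 0 < orient p q a) (hb : 0 < orient p q b) : 0 < orient p q x := by
  obtain ⟨t, h0, h1, rfl⟩ := mem_segment_lineMap.1 hx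
  rw [orient_lineMap]
  rcases h0.eq_or_lt with rfl | h0
  · simpa using ha
  have := mul_nonneg (sub_nonneg.2 h1) ha.le
  have := mul_pos h0 hb
  linarith

lemma orient_eq_zero_of_mem_segment {p q x : ℂ} (hx : x ∈ segment ℝ p q) :
    orient p q x = 0 := by
  obtain ⟨t, h0, h1, rfl⟩ := mem_segment_lineMap.1 hx
  rw [orient_lineMap]; simp

/-- A point of the closed triangle on the line through one side lies on this side. -/
lemma mem_segment_of_orient {a b c x : ℂ} (hD : 0 < orient a b c) (h0 : orient a b x = 0)
    (h1 : 0 ≤ orient b c x) (h2 : 0 ≤ orient c a x) : x ∈ segment ℝ a b := by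
  have hs : orient a b x + orient b c x + orient c a x = orient a b c := by
    simp only [orient]; ring
  refine mem_segment_lineMap.2 ⟨orient c a x / orient a b c, by positivity, ?_, ?_⟩
  · rw [div_le_one hD]; linarith
  · have h1x : (b.re - a.re) * orient c a x = orient a b c * (x.re - a.re) := by
      have : (b.re - a.re) * orient c a x = orient a b c * (x.re - a.re)
        - orient a b x * (c.re - a.re) := by simp only [orient]; ring
      rw [this, h0]; ring
    have h1y : (b.im - a.im) * orient c a x = orient a b c * (x.im - a.im) := by
      have : (b.im - a.im) * orient c a x = orient a b c * (x.im - a.im)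
        - orient a b x * (c.im - a.im) := by simp only [orient]; ring
      rw [this, h0]; ring
    have hD' := hD.ne'
    apply Complex.ext
    · simp only [AffineMap.lineMap_apply, vsub_eq_sub, vadd_eq_add, Complex.add_re,
        Complex.sub_re, Complex.real_smul, Complex.mul_re, Complex.ofReal_re, Complex.ofReal_im,
        Complex.sub_im]
      field_simp
      linarith
    · simp only [AffineMap.lineMap_apply, vsub_eq_sub, vadd_eq_add, Complex.add_im,
        Complex.sub_im, Complex.real_smul, Complex.mul_im, Complex.ofReal_re, Complex.ofReal_im,
        Complex.sub_re]
      field_simp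
      linarith

lemma mem_openSegment_of_orient {a b c x : ℂ} (h0 : orient a b x = 0)
    (h1 : 0 < orient b c x) (h2 : 0 < orient c a x) : x ∈ openSegment ℝ a b := by
  have hs : orient a b x + orient b c x + orient c a x = orient a b c := by
    simp only [orient]; ring
  refine mem_openSegment_of_ne_left_right ?_ ?_
    (mem_segment_of_orient (by linarith) h0 h1.le h2.le)
  · rintro rfl; simp at h2
  · rintro rfl; simp at h1

/-- Intermediate value theorem along a segment. -/
lemma exists_zero_mem_segment {f : ℂ → ℝ} (hf : Continuous f) {x y : ℂ} (hx : 0 < f x)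
    (hy : f y ≤ 0) : ∃ z ∈ segment ℝ x y, z ≠ x ∧ f z = 0 := by
  have hc : Continuous fun t : ℝ => f (AffineMap.lineMap x y t) :=
    hf.comp AffineMap.lineMap_continuous
  have := intermediate_value_Icc' (zero_le_one' ℝ) hc.continuousOn
  obtain ⟨t, ht, h⟩ := this (show (0 : ℝ) ∈ _ by simpa using ⟨hy, hx.le⟩)
  refine ⟨_, mem_segment_lineMap.2 ⟨t, ht.1, ht.2, rfl⟩, ?_, h⟩
  rintro he
  simp only at h
  rw [he] at h; exact hx.ne' h

lemma exists_zero_mem_openSegment {f : ℂ → ℝ} (hf : Continuous f) {x y : ℂ} (hx : 0 < f x)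
    (hy : f y < 0) : ∃ z ∈ openSegment ℝ x y, f z = 0 := by
  obtain ⟨z, hz, hzx, h⟩ := exists_zero_mem_segment hf hx hy.le
  refine ⟨z, mem_openSegment_of_ne_left_right hzx.symm ?_ hz, h⟩
  rintro rfl; exact hy.ne h

/-- `x` lies in the open triangle with the counterclockwise vertices `a`, `b`, `c`. -/
def InTriangle (a b c x : ℂ) : Prop :=
  0 < orient a b x ∧ 0 < orient b c x ∧ 0 < orient c a x

lemma InTriangle.rotate {a b c x : ℂ} (h : InTriangle a b c x) : InTriangle b c a x :=
  ⟨h.2.1, h.2.2, h.1⟩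

lemma InTriangle.orient_pos {a b c x : ℂ} (h : InTriangle a b c x) : 0 < orient a b c := by
  have hs : orient a b x + orient b c x + orient c a x = orient a b c := by
    simp only [orient]; ring
  obtain ⟨h1, h2, h3⟩ := h
  linarith

lemma InTriangle.of_mem_segment {a b c x y z : ℂ} (hx : InTriangle a b c x) (hy : InTriangle a b c y)
    (hz : z ∈ segment ℝ x y) : InTriangle a b c z :=
  ⟨orient_pos_of_mem_segment hz hx.1 hy.1, orient_pos_of_mem_segment hz hx.2.1 hy.2.1,
    orient_pos_of_mem_segment hz hx.2.2 hy.2.2⟩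

/-- A segment that leaves an open triangle meets one of the sides. -/
lemma InTriangle.exists_exit {a b c x y : ℂ} (hx : InTriangle a b c x)
    (hy : ¬ InTriangle a b c y) :
    ∃ z ∈ segment ℝ x y, z ≠ x ∧
      (z ∈ segment ℝ a b ∨ z ∈ segment ℝ b c ∨ z ∈ segment ℝ c a) := by
  have hD := hx.orient_pos
  obtain ⟨z, hz, hzx, h⟩ := exists_zero_mem_segment
    (f := fun x => min (min (orient a b x) (orient b c x)) (orient c a x))
    (by fun_prop) (x := x) (y := y) (by simpa [InTriangle, and_assoc] using hx)
    (by simpa only [InTriangle, ← lt_min_iff, not_lt, min_assoc] using hy)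
  have hle := h.ge
  simp only [le_min_iff] at hle
  refine ⟨z, hz, hzx, ?_⟩
  rcases min_choice (min (orient a b z) (orient b c z)) (orient c a z) with h1 | h1
  · rcases min_choice (orient a b z) (orient b c z) with h2 | h2
    · left
      exact mem_segment_of_orient hD (by rw [← h2, ← h1, h]) hle.1.2 hle.2
    · right; left
      exact mem_segment_of_orient (by rwa [orient_rotate]) (by rw [← h2, ← h1, h]) hle.2 hle.1.1
  · right; right
    exact mem_segment_of_orient (by rwa [← orient_rotate]) (by rw [← h1, h]) hle.1.1 hle.1.2

lemma exists_lineMap_eq_of_orient_eq_zero {a b x : ℂ} (hab : a ≠ b) (hx : orient a b x = 0) :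
    ∃ t : ℝ, AffineMap.lineMap a b t = x := by
  have hn : (b.re - a.re) ^ 2 + (b.im - a.im) ^ 2 ≠ 0 := by
    intro h
    apply hab
    apply Complex.ext <;> nlinarith [sq_nonneg (b.re - a.re), sq_nonneg (b.im - a.im)]
  refine ⟨((x.re - a.re) * (b.re - a.re) + (x.im - a.im) * (b.im - a.im)) /
    ((b.re - a.re) ^ 2 + (b.im - a.im) ^ 2), ?_⟩
  simp only [orient] at hx
  apply Complex.ext
  · simp only [AffineMap.lineMap_apply, vsub_eq_sub, vadd_eq_add, Complex.add_re,
      Complex.sub_re, Complex.real_smul, Complex.mul_re, Complex.ofReal_re, Complex.ofReal_im,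
      Complex.sub_im]
    field_simp
    linear_combination (b.im - a.im) * hx
  · simp only [AffineMap.lineMap_apply, vsub_eq_sub, vadd_eq_add, Complex.add_im,
      Complex.sub_im, Complex.real_smul, Complex.mul_im, Complex.ofReal_re, Complex.ofReal_im,
      Complex.sub_re]
    field_simp
    linear_combination (-(b.re - a.re)) * hx

/-- Two collinear overlapping open segments, neither of which contains an endpoint of the other,
have the same endpoints. -/
lemma eq_of_overlap {a b p q y : ℂ} (hab : a ≠ b) (hy : y ∈ openSegment ℝ a b)
    (hy' : y ∈ openSegment ℝ p q) (hp : orient a b p = 0)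
    (hpab : p ∉ openSegment ℝ a b) (hqab : q ∉ openSegment ℝ a b)
    (hapq : a ∉ openSegment ℝ p q) (hbpq : b ∉ openSegment ℝ p q) : s(p, q) = s(a, b) := by
  have hq : orient a b q = 0 := by
    obtain ⟨t, h0, h1, rfl⟩ := mem_openSegment_lineMap.1 hy'
    have h := orient_eq_zero_of_mem_segment (openSegment_subset_segment ℝ a b hy)
    rw [orient_lineMap, hp] at h
    have : t ≠ 0 := h0.ne'
    simpa [this] using h
  obtain ⟨s, rfl⟩ := exists_lineMap_eq_of_orient_eq_zero hab hp
  obtain ⟨r, rfl⟩ := exists_lineMap_eq_of_orient_eq_zero hab hq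
  obtain ⟨t, ht0, ht1, rfl⟩ := mem_openSegment_lineMap.1 hy
  obtain ⟨w, hw0, hw1, hw⟩ := mem_openSegment_lineMap.1 hy'
  have hinj : Function.Injective (AffineMap.lineMap a b : ℝ → ℂ) :=
    AffineMap.lineMap_injective ℝ hab
  have comp : ∀ s r w : ℝ, AffineMap.lineMap (AffineMap.lineMap a b s : ℂ)
      (AffineMap.lineMap a b r) w = (AffineMap.lineMap a b ((1 - w) * s + w * r) : ℂ) := by
    intro s r w
    simp only [AffineMap.lineMap_apply, vsub_eq_sub, vadd_eq_add, Complex.real_smul]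
    push_cast; ring
  rw [comp] at hw
  have hw := hinj hw
  have mem1 : ∀ s : ℝ, ¬ (AffineMap.lineMap a b s : ℂ) ∈ openSegment ℝ a b → s ≤ 0 ∨ 1 ≤ s := by
    intro s h
    by_contra! h'
    exact h (mem_openSegment_lineMap.2 ⟨s, h'.1, h'.2, rfl⟩)
  have mem2 : ∀ s r x : ℝ, s < x → x < r → (AffineMap.lineMap a b x : ℂ) ∈
      openSegment ℝ (AffineMap.lineMap a b s : ℂ) (AffineMap.lineMap a b r) := by
    intro s r x h1 h2
    have hsr : (r - s) ≠ 0 := by linarith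
    refine mem_openSegment_lineMap.2 ⟨(x - s) / (r - s), div_pos (by linarith) (by linarith), ?_, ?_⟩
    · rw [div_lt_one (by linarith)]; linarith
    · rw [comp]; congr 1; field_simp; ring
  have main : ∀ s r w : ℝ, 0 < w → w < 1 → (1 - w) * s + w * r = t → (s ≤ 0 ∨ 1 ≤ s) →
      (r ≤ 0 ∨ 1 ≤ r) → s < r → ¬ (s < 0 ∧ 0 < r) → ¬ (s < 1 ∧ 1 < r) → s = 0 ∧ r = 1 := by
    intro s r w hw0 hw1 hw hs hr hsr h0 h1
    have hst : s < t := by nlinarith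
    have htr : t < r := by nlinarith
    have hs' : s ≤ 0 := by rcases hs with h | h <;> linarith
    have hr' : 1 ≤ r := by rcases hr with h | h <;> linarith
    constructor
    · by_contra h
      exact h0 ⟨lt_of_le_of_ne hs' h, by linarith⟩
    · by_contra h
      exact h1 ⟨by linarith, lt_of_le_of_ne hr' (Ne.symm h)⟩
  have ha0 : (AffineMap.lineMap a b (0 : ℝ) : ℂ) = a := by simp
  have hb1 : (AffineMap.lineMap a b (1 : ℝ) : ℂ) = b := by simp
  rcases lt_trichotomy s r with h | h | h
  · obtain ⟨rfl, rfl⟩ := main s r w hw0 hw1 hw (mem1 s hpab) (mem1 r hqab) h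
      (fun h' => hapq (by simpa using mem2 s r 0 h'.1 h'.2))
      (fun h' => hbpq (by simpa using mem2 s r 1 h'.1 h'.2))
    simp
  · subst h
    exfalso
    have : s = t := by linarith
    rcases mem1 s hpab with h | h <;> linarith
  · obtain ⟨rfl, rfl⟩ := main r s (1 - w) (by linarith) (by linarith) (by linarith)
      (mem1 r hqab) (mem1 s hpab) h
      (fun h' => hapq (by rw [openSegment_symm]; simpa using mem2 r s 0 h'.1 h'.2))
      (fun h' => hbpq (by rw [openSegment_symm]; simpa using mem2 r s 1 h'.1 h'.2))
    simp [Sym2.eq_swap]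

/-- The Grassmann–Plücker relation for four points seen from a fifth one. -/
lemma orient_pluecker (o a b c d : ℂ) :
    orient o a b * orient o c d - orient o a c * orient o b d + orient o a d * orient o b c = 0 := by
  simp only [orient]; ring

/-- The diagonals of a convex quadrilateral `a b c d` cross. -/
lemma exists_mem_openSegment_of_orient {a b c d : ℂ} (h1 : 0 < orient a b c)
    (h2 : 0 < orient a b d) (h3 : 0 < orient c d a) (h4 : 0 < orient c d b) :
    ∃ x, x ∈ openSegment ℝ a c ∧ x ∈ openSegment ℝ b d := by
  obtain ⟨x, hx, h0⟩ := exists_zero_mem_openSegment (continuous_orient a c) (x := d) (y := b)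
    (by rwa [orient_rotate] at h3) (by rw [orient_swap_right]; linarith)
  rw [openSegment_symm] at hx
  refine ⟨x, mem_openSegment_of_orient (c := d) h0 ?_ ?_, hx⟩
  · exact orient_pos_of_mem_openSegment hx h4 (by simp)
  · exact orient_pos_of_mem_openSegment hx (by rwa [← orient_rotate]) (by simp)

/-! ### The winding number of a polygon -/

variable {N : ℕ} {v : Fin N → ℂ}

lemma vertex_mem_polygonBoundary (v : Fin N → ℂ) (i : Fin N) : v i ∈ polygonBoundary v :=
  mem_iUnion.2 ⟨i, left_mem_segment ℝ _ _⟩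

lemma isClosed_segment (a b : ℂ) : IsClosed (segment ℝ a b) := by
  rw [segment_eq_image_lineMap]
  exact (isCompact_Icc.image AffineMap.lineMap_continuous).isClosed

lemma isClosed_polygonBoundary (v : Fin N → ℂ) : IsClosed (polygonBoundary v) :=
  isClosed_iUnion_of_finite fun _ => isClosed_segment _ _

lemma div_mem_slitPlane {a b x : ℂ} (hx : x ∉ segment ℝ a b) :
    (b - x) / (a - x) ∈ Complex.slitPlane := by
  rw [Complex.mem_slitPlane_iff]
  by_contra! h
  obtain ⟨hre, him⟩ := h
  have ha : a - x ≠ 0 := by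
    intro h
    exact hx (by rw [← sub_eq_zero.1 h]; exact left_mem_segment ℝ _ _)
  set z := (b - x) / (a - x) with hz
  have hzr : z = (z.re : ℂ) := Complex.ext (by simp) (by simp [him])
  have hb : b - x = z.re * (a - x) := by rw [← hzr, hz]; field_simp
  apply hx
  refine mem_segment_lineMap.2 ⟨1 / (1 - z.re), by apply div_nonneg <;> linarith, ?_, ?_⟩
  · rw [div_le_one (by linarith)]; linarith
  · have h1 : (1 - (z.re : ℂ)) ≠ 0 := by
      have : (1 - z.re) ≠ 0 := by linarith
      exact_mod_cast this
    simp only [AffineMap.lineMap_apply, vsub_eq_sub, vadd_eq_add, Complex.real_smul]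
    push_cast
    field_simp
    linear_combination hb

lemma continuousAt_arg_div {a b x : ℂ} (hx : x ∉ segment ℝ a b) :
    ContinuousAt (fun x => Complex.arg ((b - x) / (a - x))) x := by
  have ha : a - x ≠ 0 := by
    intro h
    exact hx (by rw [← sub_eq_zero.1 h]; exact left_mem_segment ℝ _ _)
  have h1 : ContinuousAt (fun x => (b - x) / (a - x)) x :=
    (continuousAt_const.sub continuousAt_id).div (continuousAt_const.sub continuousAt_id) ha
  exact ContinuousAt.comp (f := fun x => (b - x) / (a - x)) (g := Complex.arg)
    (Complex.continuousAt_arg (div_mem_slitPlane hx)) h1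

lemma notMem_segment_of_notMem_boundary {x : ℂ} (hx : x ∉ polygonBoundary v) (i : Fin N) :
    x ∉ segment ℝ (v i) (v (finRotate N i)) :=
  fun h => hx (mem_iUnion.2 ⟨i, h⟩)

lemma continuousAt_windingNumber {x : ℂ} (hx : x ∉ polygonBoundary v) :
    ContinuousAt (windingNumber v) x := by
  unfold windingNumber
  refine ContinuousAt.div_const ?_ _
  exact tendsto_finsetSum _ fun i _ =>
    continuousAt_arg_div (notMem_segment_of_notMem_boundary hx i)

/-- The winding number is an integer, because the product of the quotients
`(v (i + 1) - x) / (v i - x)` telescopes to `1`. -/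
lemma exists_windingNumber_eq_intCast {x : ℂ} (hx : x ∉ polygonBoundary v) :
    ∃ k : ℤ, windingNumber v x = k := by
  have hne : ∀ i, v i - x ≠ 0 := by
    intro i h
    exact hx (by rw [← sub_eq_zero.1 h]; exact vertex_mem_polygonBoundary v i)
  set z : Fin N → ℂ := fun i => (v (finRotate N i) - x) / (v i - x) with hz
  have hz0 : ∀ i, z i ≠ 0 := fun i => div_ne_zero (hne _) (hne _)
  have hprod : ∏ i, z i = 1 := by
    rw [hz, Finset.prod_div_distrib, Equiv.prod_comp (finRotate N) (fun i => v i - x)]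
    exact div_self (Finset.prod_ne_zero_iff.2 fun i _ => hne i)
  have hnorm : ∏ i, ((‖z i‖ : ℝ) : ℂ) = 1 := by
    rw [← Complex.ofReal_prod, ← norm_prod, hprod]; simp
  have hexp : Complex.exp ((∑ i, Complex.arg (z i) : ℝ) * Complex.I) = 1 := by
    rw [Complex.ofReal_sum, Finset.sum_mul, Complex.exp_sum, ← one_mul (∏ i, _), ← hnorm,
      ← Finset.prod_mul_distrib]
    simp only [Complex.norm_mul_exp_arg_mul_I]
    rw [hprod]
    exact hnorm.symm
  obtain ⟨k, hk⟩ := Complex.exp_eq_one_iff.1 hexp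
  refine ⟨k, ?_⟩
  have hk' : (∑ i, Complex.arg (z i)) = k * (2 * Real.pi) := by
    have : ((∑ i, Complex.arg (z i) : ℝ) : ℂ) = ((k * (2 * Real.pi) : ℝ) : ℂ) := by
      push_cast at hk ⊢
      refine mul_right_cancel₀ Complex.I_ne_zero ?_
      rw [hk]; ring
    exact_mod_cast this
  unfold windingNumber
  rw [hk']
  field_simp

lemma isOpen_polygonInterior (v : Fin N → ℂ) : IsOpen (polygonInterior v) := by
  have h : ContinuousOn (windingNumber v) (polygonBoundary v)ᶜ :=
    fun x hx => (continuousAt_windingNumber hx).continuousWithinAt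
  exact h.isOpen_inter_preimage (isClosed_polygonBoundary v).isOpen_compl
    (isOpen_compl_singleton (x := (0 : ℝ)))

/-- A segment that avoids the boundary stays on one side of it. -/
lemma mem_polygonInterior_of_segment {x y : ℂ} (hx : x ∈ polygonInterior v)
    (h : Disjoint (segment ℝ x y) (polygonBoundary v)) : y ∈ polygonInterior v := by
  have hy := Set.disjoint_left.1 h (right_mem_segment ℝ x y)
  refine ⟨hy, ?_⟩
  have hconst : windingNumber v x = windingNumber v y := by
    have hc : ContinuousOn (windingNumber v) (segment ℝ x y) := fun z hz =>
      (continuousAt_windingNumber (Set.disjoint_left.1 h hz)).continuousWithinAt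
    have hd : IsDiscrete (range ((↑) : ℤ → ℝ)) :=
      Int.isClosedEmbedding_coe_real.isEmbedding.isDiscrete_range
    refine (convex_segment x y).isPreconnected.constant_of_mapsTo (T := range ((↑) : ℤ → ℝ)) hd hc
      ?_ (left_mem_segment ℝ x y) (right_mem_segment ℝ x y)
    intro z hz
    obtain ⟨k, hk⟩ := exists_windingNumber_eq_intCast (Set.disjoint_left.1 h hz)
    exact ⟨k, hk.symm⟩
  rw [← hconst]
  exact hx.2

lemma im_div_eq (a b x : ℂ) : ((b - x) / (a - x)).im = orient a b x / Complex.normSq (a - x) := by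
  simp only [Complex.div_im, orient, Complex.sub_re, Complex.sub_im]
  ring

lemma mem_closure_side {a b y : ℂ} (hab : a ≠ b) (hy : orient a b y = 0) (s : ℝ) (hs : s ≠ 0) :
    y ∈ closure {x | 0 < s * orient a b x} := by
  have hn : 0 < (b.re - a.re) ^ 2 + (b.im - a.im) ^ 2 := by
    by_contra! h
    apply hab
    apply Complex.ext <;> nlinarith [sq_nonneg (b.re - a.re), sq_nonneg (b.im - a.im)]
  set w : ℂ := y + s * Complex.I * (b - a) with hw
  have how : orient a b w = s * ((b.re - a.re) ^ 2 + (b.im - a.im) ^ 2) := by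
    have : orient a b w = orient a b y + s * ((b.re - a.re) ^ 2 + (b.im - a.im) ^ 2) := by
      simp [orient, hw]; ring
    rw [this, hy, zero_add]
  refine closure_mono ?_ (segment_subset_closure_openSegment (left_mem_segment ℝ y w))
  intro x hx
  obtain ⟨t, h0, h1, rfl⟩ := mem_openSegment_lineMap.1 hx
  simp only [mem_ofPred_eq, orient_lineMap, hy, how]
  have := mul_pos h0 (mul_pos (mul_self_pos.2 hs) hn)
  nlinarith

lemma IsSimplePolygon.ne_finRotate (hv : IsSimplePolygon v) (i : Fin N) :
    v i ≠ v (finRotate N i) := by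
  intro h
  obtain ⟨m, rfl⟩ : ∃ m, N = m + 2 := ⟨N - 2, by have := hv.three_le; omega⟩
  have : finRotate (m + 2) i ≠ i := Equiv.Perm.mem_support.1 (by rw [support_finRotate]; simp)
  exact this (hv.injective h).symm

/-- Near a relative interior point of an edge of a counterclockwise simple polygon, the left side
of the edge lies in the interior and the right side in the exterior: the winding number jumps by
`1` across the edge, and it takes only the values `0` and `1`. -/
lemma IsSimplePolygon.eventually_sides (hv : IsSimplePolygon v) (i : Fin N) {y : ℂ}
    (hy : y ∈ openSegment ℝ (v i) (v (finRotate N i))) :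
    ∀ᶠ x in 𝓝 y, (0 < orient (v i) (v (finRotate N i)) x → x ∈ polygonInterior v) ∧
      (orient (v i) (v (finRotate N i)) x < 0 → x ∉ polygonRegion v) := by
  classical
  set a := v i with ha
  set b := v (finRotate N i) with hb
  have hab : a ≠ b := hv.ne_finRotate i
  have hya : y ≠ a := by
    rintro rfl
    exact hab (left_mem_openSegment_iff.1 hy)
  have hyb : y ≠ b := by
    rintro rfl
    exact hab (right_mem_openSegment_iff.1 hy)
  have hother : ∀ j, j ≠ i → y ∉ segment ℝ (v j) (v (finRotate N j)) := by
    intro j hj h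
    have := hv.edges_inter j i hj ⟨h, openSegment_subset_segment ℝ _ _ hy⟩
    rcases this.2 with h | h
    · exact hya h
    · exact hyb h
  have hy0 : orient a b y = 0 := orient_eq_zero_of_mem_segment (openSegment_subset_segment ℝ _ _ hy)
  set f : ℂ → ℝ := fun x =>
    ∑ j ∈ Finset.univ.erase i, Complex.arg ((v (finRotate N j) - x) / (v j - x)) with hf
  set g : ℂ → ℝ := fun x => Complex.arg ((b - x) / (a - x)) with hg
  have hW : ∀ x, windingNumber v x = (f x + g x) / (2 * Real.pi) := by
    intro x
    rw [windingNumber, hf, hg]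
    congr 1
    exact (Finset.sum_erase_add _ _ (Finset.mem_univ i)).symm
  have hfc : Tendsto f (𝓝 y) (𝓝 (f y)) := tendsto_finsetSum _ fun j hj =>
    continuousAt_arg_div (hother j (Finset.ne_of_mem_erase hj))
  -- the quotient of the edge that is crossed tends to a negative real number
  have hq : Tendsto (fun x => (b - x) / (a - x)) (𝓝 y) (𝓝 ((b - y) / (a - y))) :=
    (tendsto_const_nhds.sub tendsto_id).div (tendsto_const_nhds.sub tendsto_id)
      (sub_ne_zero.2 hya.symm)
  have him : ((b - y) / (a - y)).im = 0 := by rw [im_div_eq, hy0, zero_div]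
  have hre : ((b - y) / (a - y)).re < 0 := by
    obtain ⟨t, h0, h1, rfl⟩ := mem_openSegment_lineMap.1 hy
    have h2 : a - AffineMap.lineMap a b t = -((t : ℂ) * (b - a)) := by
      simp only [AffineMap.lineMap_apply, vsub_eq_sub, vadd_eq_add, Complex.real_smul]; ring
    have h3 : b - AffineMap.lineMap a b t = (1 - t : ℂ) * (b - a) := by
      simp only [AffineMap.lineMap_apply, vsub_eq_sub, vadd_eq_add, Complex.real_smul]; ring
    have hba : b - a ≠ 0 := sub_ne_zero.2 hab.symm
    have ht : (t : ℂ) ≠ 0 := by exact_mod_cast h0.ne'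
    have : (b - AffineMap.lineMap a b t) / (a - AffineMap.lineMap a b t)
        = ((-((1 - t) / t) : ℝ) : ℂ) := by
      rw [h2, h3]; push_cast; field_simp
    rw [this, Complex.ofReal_re]
    have := div_pos (sub_pos.2 h1) h0
    linarith
  have hnear : ∀ᶠ x in 𝓝 y, ∀ j, j ≠ i → x ∉ segment ℝ (v j) (v (finRotate N j)) := by
    rw [eventually_all]
    intro j
    by_cases hj : j = i
    · simp [hj]
    · simp only [ne_eq, hj, not_false_eq_true, forall_const]
      exact (isClosed_segment _ _).isOpen_compl.mem_nhds (hother j hj)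
  have hoff : ∀ᶠ x in 𝓝 y, orient a b x ≠ 0 → x ∉ polygonBoundary v := by
    filter_upwards [hnear] with x hx h0 hmem
    obtain ⟨j, hj⟩ := mem_iUnion.1 hmem
    by_cases hji : j = i
    · subst hji
      exact h0 (orient_eq_zero_of_mem_segment hj)
    · exact hx j hji hj
  have hW01 : ∀ x, x ∉ polygonBoundary v → windingNumber v x = 0 ∨ windingNumber v x = 1 := by
    intro x hx
    by_cases h : windingNumber v x = 0
    · exact Or.inl h
    · exact Or.inr (hv.counterclockwise x ⟨hx, h⟩)
  have hL : Tendsto (windingNumber v) (𝓝[{x | 0 < orient a b x}] y)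
      (𝓝 ((f y + Real.pi) / (2 * Real.pi))) := by
    simp_rw [funext hW]
    refine ((hfc.mono_left nhdsWithin_le_nhds).add ?_).div_const _
    refine (Complex.tendsto_arg_nhdsWithin_im_nonneg_of_re_neg_of_im_zero hre him).comp ?_
    refine tendsto_nhdsWithin_iff.2 ⟨hq.mono_left nhdsWithin_le_nhds, ?_⟩
    filter_upwards [self_mem_nhdsWithin] with x hx
    simp only [im_div_eq] at hx ⊢
    exact div_nonneg hx.le (Complex.normSq_nonneg _)
  have hR : Tendsto (windingNumber v) (𝓝[{x | orient a b x < 0}] y)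
      (𝓝 ((f y + -Real.pi) / (2 * Real.pi))) := by
    simp_rw [funext hW]
    refine ((hfc.mono_left nhdsWithin_le_nhds).add ?_).div_const _
    refine (Complex.tendsto_arg_nhdsWithin_im_neg_of_re_neg_of_im_zero hre him).comp ?_
    refine tendsto_nhdsWithin_iff.2 ⟨hq.mono_left nhdsWithin_le_nhds, ?_⟩
    have hxa : ∀ᶠ x in 𝓝[{x | orient a b x < 0}] y, x ≠ a :=
      nhdsWithin_le_nhds (isOpen_compl_singleton.mem_nhds hya)
    filter_upwards [self_mem_nhdsWithin, hxa] with x hx hxa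
    simp only [im_div_eq] at hx ⊢
    exact div_neg_of_neg_of_pos hx (Complex.normSq_pos.2 (sub_ne_zero.2 hxa.symm))
  have hLne : (𝓝[{x | 0 < orient a b x}] y).NeBot :=
    mem_closure_iff_nhdsWithin_neBot.1 (by simpa using mem_closure_side hab hy0 1 one_ne_zero)
  have hRne : (𝓝[{x | orient a b x < 0}] y).NeBot :=
    mem_closure_iff_nhdsWithin_neBot.1
      (by simpa using mem_closure_side hab hy0 (-1) (by norm_num))
  have hclosed : IsClosed ({0, 1} : Set ℝ) := (Set.toFinite _).isClosed
  have hLmem : (f y + Real.pi) / (2 * Real.pi) ∈ ({0, 1} : Set ℝ) := by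
    refine hclosed.mem_of_tendsto hL ?_
    filter_upwards [self_mem_nhdsWithin, nhdsWithin_le_nhds hoff] with x hx h
    exact hW01 x (h (ne_of_gt hx))
  have hRmem : (f y + -Real.pi) / (2 * Real.pi) ∈ ({0, 1} : Set ℝ) := by
    refine hclosed.mem_of_tendsto hR ?_
    filter_upwards [self_mem_nhdsWithin, nhdsWithin_le_nhds hoff] with x hx h
    exact hW01 x (h (ne_of_lt hx))
  have hpi := Real.pi_pos
  have hsplit : (f y + Real.pi) / (2 * Real.pi) = (f y + -Real.pi) / (2 * Real.pi) + 1 := by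
    field_simp; ring
  have hL1 : (f y + Real.pi) / (2 * Real.pi) = 1 := by
    rcases hLmem with h | h
    · rcases hRmem with h' | h'
      · rw [hsplit, h'] at h; norm_num at h
      · rw [hsplit, h'] at h; norm_num at h
    · exact h
  have hR0 : (f y + -Real.pi) / (2 * Real.pi) = 0 := by linarith
  rw [hL1] at hL
  rw [hR0] at hR
  have hLev := eventually_nhdsWithin_iff.1 (hL.eventually (lt_mem_nhds (show (0 : ℝ) < 1 by norm_num)))
  have hRev := eventually_nhdsWithin_iff.1 (hR.eventually (gt_mem_nhds (show (0 : ℝ) < 1 by norm_num)))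
  filter_upwards [hLev, hRev, hoff] with x h1 h2 h3
  refine ⟨fun h => ⟨h3 h.ne', (h1 h).ne'⟩, fun h hmem => ?_⟩
  rcases hmem with hmem | hmem
  · exact h3 h.ne hmem
  · have := hv.counterclockwise x hmem
    exact absurd (h2 h) (by rw [this]; norm_num)

/-- If the region bounded by `w` is contained in the one bounded by the simple polygon `v`, then
the interiors are contained in each other as well: a boundary point of `v` is a limit of exterior
points. -/
lemma IsSimplePolygon.polygonInterior_subset (hv : IsSimplePolygon v) {M : ℕ} {w : Fin M → ℂ}
    (h : polygonRegion w ⊆ polygonRegion v) : polygonInterior w ⊆ polygonInterior v := by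
  intro x hx
  rcases h (Or.inr hx) with hb | hi
  swap
  · exact hi
  exfalso
  obtain ⟨i, hi⟩ := mem_iUnion.1 hb
  obtain ⟨y, hyw, hy⟩ := mem_closure_iff.1 (segment_subset_closure_openSegment hi) _
    (isOpen_polygonInterior w) hx
  have hab := hv.ne_finRotate i
  have hcl := mem_closure_side hab
    (orient_eq_zero_of_mem_segment (openSegment_subset_segment ℝ _ _ hy)) (-1) (by norm_num)
  obtain ⟨z, hz1, hz2⟩ := ((mem_closure_iff_frequently.1 hcl).and_eventually
    ((hv.eventually_sides i hy).and ((isOpen_polygonInterior w).mem_nhds hyw))).exists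
  exact hz2.1.2 (by simpa using hz1) (h (Or.inr hz2.2))

/-! ### Visibility and triangulations -/

lemma adj_visibilityGraph_edge (hv : IsSimplePolygon v) (i : Fin N) :
    (visibilityGraph v).Adj (v i) (v (finRotate N i)) :=
  ⟨hv.ne_finRotate i, Or.inl ⟨i, rfl⟩⟩

lemma left_mem_range_of_adj {a b : ℂ} (h : (visibilityGraph v).Adj a b) : a ∈ range v := by
  rcases h.2 with ⟨i, hi⟩ | h
  · rcases Sym2.eq_iff.1 hi with ⟨rfl, -⟩ | ⟨rfl, -⟩ <;> exact mem_range_self _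
  · exact h.1

lemma right_mem_range_of_adj {a b : ℂ} (h : (visibilityGraph v).Adj a b) : b ∈ range v :=
  left_mem_range_of_adj h.symm

/-- A vertex on an edge of a simple polygon is an endpoint of this edge. -/
lemma IsSimplePolygon.eq_of_mem_edge (hv : IsSimplePolygon v) {i j : Fin N}
    (h : v j ∈ segment ℝ (v i) (v (finRotate N i))) : v j = v i ∨ v j = v (finRotate N i) := by
  by_cases hij : i = j
  · exact Or.inl (by rw [hij])
  · exact (hv.edges_inter i j hij ⟨h, left_mem_segment ℝ _ _⟩).1

lemma ne_of_mem_openSegment {a b y : ℂ} (hab : a ≠ b) (hy : y ∈ openSegment ℝ a b) :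
    y ≠ a ∧ y ≠ b := by
  constructor
  · rintro rfl; exact hab (left_mem_openSegment_iff.1 hy)
  · rintro rfl; exact hab (right_mem_openSegment_iff.1 hy)

/-- An edge of the polygon meets the open segment between two vertices that see each other only
if it is the segment between them. -/
lemma IsSimplePolygon.disjoint_edge (hv : IsSimplePolygon v) {a b : ℂ}
    (h : (visibilityGraph v).Adj a b) (i : Fin N) (hi : s(v i, v (finRotate N i)) ≠ s(a, b)) :
    Disjoint (openSegment ℝ a b) (segment ℝ (v i) (v (finRotate N i))) := by
  rw [Set.disjoint_left]
  intro y hy hyi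
  rcases h.2 with ⟨j, hj⟩ | ⟨-, -, hd⟩
  · have hij : i ≠ j := by rintro rfl; exact hi hj.symm
    have hne := ne_of_mem_openSegment h.1 hy
    have hyj : y ∈ segment ℝ (v j) (v (finRotate N j)) := by
      rcases Sym2.eq_iff.1 hj with ⟨rfl, rfl⟩ | ⟨rfl, rfl⟩
      · exact openSegment_subset_segment ℝ _ _ hy
      · rw [segment_symm]; exact openSegment_subset_segment ℝ _ _ hy
    have := (hv.edges_inter i j hij ⟨hyi, hyj⟩).2
    rcases Sym2.eq_iff.1 hj with ⟨rfl, rfl⟩ | ⟨rfl, rfl⟩ <;> rcases this with h | h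
    · exact hne.1 h
    · exact hne.2 h
    · exact hne.2 h
    · exact hne.1 h
  · exact (hd hy).1 (mem_iUnion.2 ⟨i, hyi⟩)

lemma IsSimplePolygon.notMem_openSegment (hv : IsSimplePolygon v) {a b : ℂ}
    (h : (visibilityGraph v).Adj a b) {x : ℂ} (hx : x ∈ range v) : x ∉ openSegment ℝ a b := by
  obtain ⟨i, rfl⟩ := hx
  intro hi
  by_cases hs : s(v i, v (finRotate N i)) = s(a, b)
  · have hne := ne_of_mem_openSegment h.1 hi
    rcases Sym2.eq_iff.1 hs with ⟨h, -⟩ | ⟨h, -⟩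
    · exact hne.1 h
    · exact hne.2 h
  · exact Set.disjoint_left.1 (hv.disjoint_edge h i hs) hi (left_mem_segment ℝ _ _)

lemma IsSimplePolygon.eq_of_mem_segment (hv : IsSimplePolygon v) {a b : ℂ}
    (h : (visibilityGraph v).Adj a b) {x : ℂ} (hx : x ∈ range v) (hs : x ∈ segment ℝ a b) :
    x = a ∨ x = b := by
  by_contra! hne
  exact hv.notMem_openSegment h hx (mem_openSegment_of_ne_left_right hne.1.symm hne.2.symm hs)

lemma mem_polygonBoundary_cases {x : ℂ} (hx : x ∈ polygonBoundary v) :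
    x ∈ range v ∨ ∃ i, x ∈ openSegment ℝ (v i) (v (finRotate N i)) := by
  obtain ⟨i, hi⟩ := mem_iUnion.1 hx
  by_cases h1 : v i = x
  · exact Or.inl ⟨i, h1⟩
  by_cases h2 : v (finRotate N i) = x
  · exact Or.inl ⟨_, h2⟩
  exact Or.inr ⟨i, mem_openSegment_of_ne_left_right h1 h2 hi⟩

/-- A closed triangle whose open triangle lies in the interior and whose sides are pairs of
vertices that see each other contains no further vertices. -/
lemma IsSimplePolygon.eq_corner (hv : IsSimplePolygon v) {a b c w : ℂ}
    (hab : (visibilityGraph v).Adj a b) (hbc : (visibilityGraph v).Adj b c)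
    (hca : (visibilityGraph v).Adj c a) (hD : 0 < orient a b c)
    (hint : ∀ x, InTriangle a b c x → x ∈ polygonInterior v) (hw : w ∈ range v)
    (h1 : 0 ≤ orient a b w) (h2 : 0 ≤ orient b c w) (h3 : 0 ≤ orient c a w) :
    w = a ∨ w = b ∨ w = c := by
  rcases h1.eq_or_lt with h | h1'
  · rcases hv.eq_of_mem_segment hab hw (mem_segment_of_orient hD h.symm h2 h3) with h | h
    · exact Or.inl h
    · exact Or.inr (Or.inl h)
  rcases h2.eq_or_lt with h | h2'
  · rcases hv.eq_of_mem_segment hbc hw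
      (mem_segment_of_orient (by rwa [orient_rotate]) h.symm h3 h1) with h | h
    · exact Or.inr (Or.inl h)
    · exact Or.inr (Or.inr h)
  rcases h3.eq_or_lt with h | h3'
  · rcases hv.eq_of_mem_segment hca hw
      (mem_segment_of_orient (by rwa [← orient_rotate]) h.symm h1 h2) with h | h
    · exact Or.inr (Or.inr h)
    · exact Or.inl h
  obtain ⟨i, rfl⟩ := hw
  exact absurd (vertex_mem_polygonBoundary v i) (hint _ ⟨h1', h2', h3'⟩).1

section Triangulation

variable {T : SimpleGraph ℂ}

/-- Maximality: an edge or diagonal that is crossed by no edge of a triangulation belongs to it. -/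
lemma IsTriangulation.adj_of_forall_disjoint (hT : IsTriangulation v T) {a b : ℂ}
    (hab : (visibilityGraph v).Adj a b)
    (h : ∀ c d, T.Adj c d → s(c, d) ≠ s(a, b) →
      Disjoint (openSegment ℝ c d) (openSegment ℝ a b)) : T.Adj a b := by
  have hle : T ⊔ SimpleGraph.fromEdgeSet {s(a, b)} ≤ T := by
    refine hT.le_of_ge ⟨sup_le hT.prop.1 ?_, ?_⟩ le_sup_left
    · intro c d hcd
      rw [SimpleGraph.fromEdgeSet_adj] at hcd
      rcases Sym2.eq_iff.1 hcd.1 with ⟨rfl, rfl⟩ | ⟨rfl, rfl⟩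
      · exact hab
      · exact hab.symm
    · have hseg : ∀ c d, s(c, d) = s(a, b) → openSegment ℝ c d = openSegment ℝ a b := by
        intro c d hcd
        rcases Sym2.eq_iff.1 hcd with ⟨rfl, rfl⟩ | ⟨rfl, rfl⟩
        · rfl
        · exact openSegment_symm ..
      intro c d e f hcd hef hne
      simp only [SimpleGraph.sup_adj, SimpleGraph.fromEdgeSet_adj, mem_singleton_iff] at hcd hef
      rcases hcd with hcd | ⟨hcd, -⟩ <;> rcases hef with hef | ⟨hef, -⟩
      · exact hT.prop.2 c d e f hcd hef hne
      · rw [hseg e f hef]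
        exact h c d hcd (by rwa [← hef])
      · rw [hseg c d hcd]
        exact (h e f hef (by rw [← hcd]; exact hne.symm)).symm
      · exact absurd (hcd.trans hef.symm) hne
  exact hle (Or.inr (by simp [hab.1]))

lemma IsTriangulation.adj_edge (hv : IsSimplePolygon v) (hT : IsTriangulation v T) (i : Fin N) :
    T.Adj (v i) (v (finRotate N i)) := by
  refine hT.adj_of_forall_disjoint (adj_visibilityGraph_edge hv i) fun c d hcd hne => ?_
  exact (hv.disjoint_edge (hT.prop.1 hcd) i hne.symm).mono_right (openSegment_subset_segment ℝ _ _)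

/-- A segment between vertices that starts in the interior and is met by no edge of the
triangulation and no vertex belongs to the triangulation. -/
lemma IsTriangulation.adj_of_uncrossed (hv : IsSimplePolygon v) (hT : IsTriangulation v T)
    {a b x : ℂ} (ha : a ∈ range v) (hb : b ∈ range v) (hab : a ≠ b)
    (hfree : ∀ z ∈ range v, z ∉ openSegment ℝ a b)
    (hx : x ∈ openSegment ℝ a b) (hxi : x ∈ polygonInterior v)
    (h : ∀ c d, T.Adj c d → s(c, d) ≠ s(a, b) →
      Disjoint (openSegment ℝ c d) (openSegment ℝ a b)) : T.Adj a b := by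
  refine hT.adj_of_forall_disjoint ?_ h
  by_cases he : ∃ i, s(a, b) = s(v i, v (finRotate N i))
  · exact ⟨hab, Or.inl he⟩
  refine ⟨hab, Or.inr ⟨ha, hb, fun y hy => mem_polygonInterior_of_segment hxi ?_⟩⟩
  rw [Set.disjoint_left]
  intro z hz hzb
  have hz' : z ∈ openSegment ℝ a b := (convex_openSegment a b).segment_subset hx hy hz
  rcases mem_polygonBoundary_cases hzb with hr | ⟨i, hi⟩
  · exact hfree z hr hz'
  · refine Set.disjoint_left.1 (h _ _ (hT.adj_edge hv i) ?_) hi hz'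
    exact fun hs => he ⟨i, hs.symm⟩

/-- An edge of the triangulation that meets the open segment between two other vertices crosses
it properly, unless that segment contains a vertex. -/
lemma IsTriangulation.exists_crossing (hv : IsSimplePolygon v) (hT : IsTriangulation v T)
    {a b c d y : ℂ} (ha : a ∈ range v) (hb : b ∈ range v) (hab : a ≠ b)
    (hfree : ∀ z ∈ range v, z ∉ openSegment ℝ a b)
    (hcd : T.Adj c d) (hne : s(c, d) ≠ s(a, b)) (hy : y ∈ openSegment ℝ a b)
    (hy' : y ∈ openSegment ℝ c d) :
    ∃ p r, T.Adj p r ∧ y ∈ openSegment ℝ p r ∧ 0 < orient a b p ∧ orient a b r < 0 := by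
  have hvis := hT.prop.1 hcd
  have hc := left_mem_range_of_adj hvis
  have hd := right_mem_range_of_adj hvis
  have h0 : orient a b c ≠ 0 := fun h0 => hne (eq_of_overlap hab hy hy' h0 (hfree c hc) (hfree d hd)
    (hv.notMem_openSegment hvis ha) (hv.notMem_openSegment hvis hb))
  have hyz : orient a b y = 0 := orient_eq_zero_of_mem_segment (openSegment_subset_segment ℝ _ _ hy)
  obtain ⟨t, ht0, ht1, rfl⟩ := mem_openSegment_lineMap.1 hy'
  rw [orient_lineMap] at hyz
  have ht1' := sub_pos.2 ht1
  rcases lt_or_gt_of_ne h0 with h | h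
  · refine ⟨d, c, hcd.symm, by rwa [openSegment_symm], ?_, h⟩
    by_contra! hd'
    nlinarith [mul_pos_of_neg_of_neg (neg_lt_zero.2 ht1') h]
  · refine ⟨c, d, hcd, hy', h, ?_⟩
    by_contra! hd'
    nlinarith [mul_pos ht1' h]

end Triangulation

/-! ### Triangles of a triangulation -/

lemma mem_openSegment_trans {p r x y : ℂ} (hy : y ∈ openSegment ℝ p r)
    (hx : x ∈ openSegment ℝ y p) : x ∈ openSegment ℝ p r := by
  obtain ⟨t, h0, h1, rfl⟩ := mem_openSegment_lineMap.1 hy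
  obtain ⟨s, h2, h3, rfl⟩ := mem_openSegment_lineMap.1 hx
  refine mem_openSegment_lineMap.2 ⟨(1 - s) * t, mul_pos (by linarith) h0, by nlinarith, ?_⟩
  simp only [AffineMap.lineMap_apply, vsub_eq_sub, vadd_eq_add, Complex.real_smul]
  push_cast; ring

lemma orient_sum (a b c x : ℂ) :
    orient a b x + orient b c x + orient c a x = orient a b c := by
  simp only [orient]; ring

/-- A segment that leaves `a` inside the angle `d a b` starts in the triangle `a b d`. -/
lemma exists_inTriangle_of_angle {a b d y : ℂ} (hD : 0 < orient a b d)
    (h1 : 0 < orient a b y) (h2 : 0 < orient d a y) :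
    ∃ x ∈ openSegment ℝ a y, InTriangle a b d x := by
  have ho : IsOpen {z | 0 < orient b d z} := isOpen_lt continuous_const (continuous_orient b d)
  obtain ⟨x, hx, hxy⟩ := mem_closure_iff.1
    (segment_subset_closure_openSegment (left_mem_segment ℝ a y)) _ ho
    (show 0 < orient b d a by rwa [orient_rotate])
  exact ⟨x, hxy, orient_pos_of_mem_openSegment' hxy (by simp) h1, hx,
    orient_pos_of_mem_openSegment' hxy (by simp) h2⟩

section

variable {T : SimpleGraph ℂ}

/-- In a triangle `a b q` two sides of which are edges of the triangulation, let `z` be the vertex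
that is seen from `b` under the smallest angle with `a`, and among those the one closest to `b`.
Then `z` is a neighbor of `a`: an edge that crosses `a z` would leave the triangle
through one of the two sides or end at a vertex under a smaller angle. -/
lemma IsTriangulation.adj_of_min_angle (hv : IsSimplePolygon v) (hT : IsTriangulation v T)
    {a b q z : ℂ} (hab : T.Adj a b) (haq : T.Adj a q) (hD : 0 < orient a b q)
    (hz : z ∈ range v) (hzα : 0 < orient a b z) (hzβ : 0 ≤ orient b q z) (hzγ : 0 < orient q a z)
    (hmin : ∀ w ∈ range v, 0 < orient a b w → 0 ≤ orient b q w → 0 ≤ orient q a w →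
      orient b q w * orient a b z ≤ orient b q z * orient a b w)
    {x : ℂ} (hx : x ∈ openSegment ℝ a z) (hxi : x ∈ polygonInterior v) : T.Adj a z := by
  have vis := fun {c d} (h : T.Adj c d) => hT.prop.1 h
  have ha := left_mem_range_of_adj (vis hab)
  have hza : a ≠ z := by rintro rfl; simp at hzα
  have hβa : 0 < orient b q a := by rwa [orient_rotate]
  have hℓa : 0 < orient b z a := by rwa [orient_rotate]
  have hfree : ∀ w ∈ range v, w ∉ openSegment ℝ a z := by
    intro w hw hwo
    have h1 : 0 < orient a b w := orient_pos_of_mem_openSegment' hwo (by simp) hzα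
    have h2 : 0 < orient b q w := orient_pos_of_mem_openSegment hwo hβa hzβ
    have h3 : 0 < orient q a w := orient_pos_of_mem_openSegment' hwo (by simp) hzγ
    have h4 := hmin w hw h1 h2.le h3.le
    obtain ⟨t, ht0, ht1, rfl⟩ := mem_openSegment_lineMap.1 hwo
    simp only [orient_lineMap, orient_self_left] at h4
    nlinarith [mul_pos (mul_pos (sub_pos.2 ht1) hβa) hzα]
  refine hT.adj_of_uncrossed hv ha hz hza hfree hx hxi fun c d hcd hne => ?_
  rw [Set.disjoint_left]
  intro y hycd hy
  obtain ⟨p, r, hpr, hypr, hp, hr⟩ := hT.exists_crossing hv ha hz hza hfree hcd hne hy hycd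
  -- barycentric coordinates determine the position relative to the lines `a z` and `b z`
  have id1 : ∀ w, orient a b q * orient a z w =
      orient a b w * orient q a z - orient a b z * orient q a w := by
    intro w; simp only [orient]; ring
  have id2 : ∀ w, orient a b q * orient b z w =
      orient a b z * orient b q w - orient a b w * orient b q z := by
    intro w; simp only [orient]; ring
  have hyα : 0 < orient a b y := orient_pos_of_mem_openSegment' hy (by simp) hzα
  have hyγ : 0 < orient q a y := orient_pos_of_mem_openSegment' hy (by simp) hzγ
  have hyℓ : 0 < orient b z y := orient_pos_of_mem_openSegment hy hℓa (by simp)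
  have hy0 : orient a z y = 0 := orient_eq_zero_of_mem_segment (openSegment_subset_segment ℝ _ _ hy)
  have hpV := left_mem_range_of_adj (vis hpr)
  have hrV := right_mem_range_of_adj (vis hpr)
  by_cases hpℓ : 0 < orient b z p
  · by_cases hpγ : 0 ≤ orient q a p
    · have h1 : 0 < orient a b p := by
        have := mul_pos hD hp
        rw [id1] at this
        exact pos_of_mul_pos_left (by nlinarith [mul_nonneg hzα.le hpγ] :
          0 < orient a b p * orient q a z) hzγ.le
      have h2 := mul_pos hD hpℓ
      rw [id2] at h2
      have h3 : 0 < orient b q p := by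
        exact pos_of_mul_pos_right (by nlinarith [mul_nonneg h1.le hzβ] :
          0 < orient a b z * orient b q p) hzα.le
      have := hmin p hpV h1 h3.le hpγ
      linarith
    · obtain ⟨x, hx, hx0⟩ := exists_zero_mem_openSegment (continuous_orient q a) hyγ
        (not_le.1 hpγ)
      have h1 : 0 < orient a z x := orient_pos_of_mem_openSegment' hx hy0.ge hp
      have h2 : 0 < orient b z x := orient_pos_of_mem_openSegment hx hyℓ hpℓ.le
      have h1 := mul_pos hD h1
      have h2 := mul_pos hD h2
      rw [id1, hx0, mul_zero, sub_zero] at h1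
      rw [id2] at h2
      have h3 : 0 < orient a b x := pos_of_mul_pos_left h1 hzγ.le
      have h4 : 0 < orient b q x :=
        pos_of_mul_pos_right (by nlinarith [mul_nonneg h3.le hzβ] :
          0 < orient a b z * orient b q x) hzα.le
      have hxq := mem_openSegment_of_orient hx0 h3 h4
      refine Set.disjoint_left.1 (hT.prop.2 p r q a hpr haq.symm ?_)
        (mem_openSegment_trans hypr hx) hxq
      intro hs
      rcases Sym2.eq_iff.1 hs with ⟨h, -⟩ | ⟨h, -⟩ <;> rw [h] at hpγ <;> simp at hpγ
  · have hrℓ : 0 < orient b z r := by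
      by_contra! hrℓ
      have h1 : 0 ≤ orient z b p := by rw [orient_swap]; linarith
      have h2 : 0 ≤ orient z b r := by rw [orient_swap]; linarith
      have := orient_nonneg_of_mem_segment (openSegment_subset_segment ℝ _ _ hypr) h1 h2
      rw [orient_swap] at this
      linarith
    have hr' := mul_neg_of_pos_of_neg hD hr
    rw [id1] at hr'
    have hrℓ' := mul_pos hD hrℓ
    rw [id2] at hrℓ'
    by_cases hrα : 0 ≤ orient a b r
    · have h1 : 0 < orient q a r :=
        pos_of_mul_pos_right (by nlinarith [mul_nonneg hrα hzγ.le] :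
          0 < orient a b z * orient q a r) hzα.le
      have h2 : 0 < orient b q r :=
        pos_of_mul_pos_right (by nlinarith [mul_nonneg hrα hzβ] :
          0 < orient a b z * orient b q r) hzα.le
      rcases hrα.eq_or_lt with h0 | h0
      · exact hv.notMem_openSegment (vis hab) hrV (mem_openSegment_of_orient h0.symm h2 h1)
      · have := hmin r hrV h0 h2.le h1.le
        linarith
    · rw [not_le] at hrα
      obtain ⟨x, hx, hx0⟩ := exists_zero_mem_openSegment (continuous_orient a b) hyα hrα
      have h1 : 0 < orient z a x := orient_pos_of_mem_openSegment' hx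
        (by rw [orient_swap]; linarith) (by rw [orient_swap]; linarith)
      have h2 : 0 < orient b z x := orient_pos_of_mem_openSegment hx hyℓ hrℓ.le
      have h1 := mul_pos hD h1
      have h2 := mul_pos hD h2
      rw [orient_swap a z x, mul_neg, id1, hx0, zero_mul, zero_sub, neg_neg] at h1
      rw [id2, hx0, zero_mul, sub_zero] at h2
      have h3 : 0 < orient q a x := pos_of_mul_pos_right h1 hzα.le
      have h4 : 0 < orient b q x := pos_of_mul_pos_right h2 hzα.le
      have hxab := mem_openSegment_of_orient hx0 h4 h3
      refine Set.disjoint_left.1 (hT.prop.2 r p a b hpr.symm hab ?_)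
        (mem_openSegment_trans (by rwa [openSegment_symm]) hx) hxab
      intro hs
      rcases Sym2.eq_iff.1 hs with ⟨h, -⟩ | ⟨h, -⟩ <;> rw [h] at hrα <;> simp at hrα

/-- If the triangle `a b q` contains no further vertex, `a b` and `a q` are edges of the
triangulation and no edge leaves `a` between them, then no edge enters the triangle, unless `b q`
is an edge as well. -/
lemma IsTriangulation.notMem_triangle_of_empty (hv : IsSimplePolygon v) (hT : IsTriangulation v T)
    {a b q : ℂ} (hab : T.Adj a b) (haq : T.Adj a q) (hbq : ¬ T.Adj b q) (hD : 0 < orient a b q)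
    (hempty : ∀ z ∈ range v, 0 ≤ orient a b z → 0 ≤ orient b q z → 0 ≤ orient q a z →
      z = a ∨ z = b ∨ z = q)
    (hangle : ∀ r, T.Adj a r → 0 < orient a b r → ¬ 0 < orient q a r)
    {p r x : ℂ} (hpr : T.Adj p r) (hx : x ∈ openSegment ℝ p r) (h1 : 0 < orient a b x)
    (h2 : 0 ≤ orient b q x) (h3 : 0 < orient q a x) : False := by
  have vis := fun {c d} (h : T.Adj c d) => hT.prop.1 h
  have ha := left_mem_range_of_adj (vis hab)
  have hb := right_mem_range_of_adj (vis hab)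
  have hq := right_mem_range_of_adj (vis haq)
  have main : ∀ p r, T.Adj p r → x ∈ openSegment ℝ p r → orient b q x ≤ orient b q p → False := by
    intro p r hpr hx hp
    have hpV := left_mem_range_of_adj (vis hpr)
    have hrV := right_mem_range_of_adj (vis hpr)
    rcases (h2.trans hp).eq_or_lt with hp0 | hp0
    · have hx0 : orient b q x = 0 := by linarith
      have hxo := mem_openSegment_of_orient hx0 h3 h1
      have hne : b ≠ q := by rintro rfl; simp at hD
      have hfree : ∀ w ∈ range v, w ∉ openSegment ℝ b q := by
        intro w hw hwo
        have hne' := ne_of_mem_openSegment hne hwo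
        have h4 : 0 < orient a b w := orient_pos_of_mem_openSegment' hwo (by simp) hD
        rcases hempty w hw h4.le
          (orient_eq_zero_of_mem_segment (openSegment_subset_segment ℝ _ _ hwo)).ge
          (orient_pos_of_mem_openSegment hwo (by rwa [← orient_rotate]) (by simp)).le with h | h | h
        · rw [h] at h4; simp at h4
        · exact hne'.1 h
        · exact hne'.2 h
      have := eq_of_overlap hne hxo hx hp0.symm (hfree p hpV) (hfree r hrV)
        (hv.notMem_openSegment (vis hpr) hb) (hv.notMem_openSegment (vis hpr) hq)
      rcases Sym2.eq_iff.1 this with ⟨rfl, rfl⟩ | ⟨rfl, rfl⟩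
      · exact hbq hpr
      · exact hbq hpr.symm
    · by_cases hin : 0 ≤ orient a b p ∧ 0 ≤ orient q a p
      · rcases hempty p hpV hin.1 hp0.le hin.2 with rfl | rfl | rfl
        · obtain ⟨t, ht0, ht1, rfl⟩ := mem_openSegment_lineMap.1 hx
          simp only [orient_lineMap, orient_self_left, orient_self_right, mul_zero, zero_add]
            at h1 h3
          exact hangle r hpr (pos_of_mul_pos_right h1 ht0.le) (pos_of_mul_pos_right h3 ht0.le)
        · simp at hp0
        · simp at hp0
      · obtain ⟨y, hy, hy0⟩ := exists_zero_mem_openSegment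
          (f := fun z => min (orient a b z) (orient q a z)) (by fun_prop) (x := x) (y := p)
          (lt_min h1 h3) (by
            by_contra! h
            exact hin ⟨h.trans (min_le_left _ _), h.trans (min_le_right _ _)⟩)
        have hyβ : 0 < orient b q y := orient_pos_of_mem_openSegment' hy h2 hp0
        have hy' := mem_openSegment_trans hx hy
        have hya : y ≠ a := by rintro rfl; exact hv.notMem_openSegment (vis hpr) ha hy'
        have hge := hy0.ge
        rw [le_min_iff] at hge
        rcases min_choice (orient a b y) (orient q a y) with h | h <;> rw [h] at hy0
        · have hyo : y ∈ openSegment ℝ a b := mem_openSegment_of_ne_left_right hya.symm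
            (by rintro rfl; simp at hyβ) (mem_segment_of_orient hD hy0 hyβ.le hge.2)
          refine Set.disjoint_left.1 (hT.prop.2 p r a b hpr hab ?_) hy' hyo
          intro hs
          have hx' : x ∈ segment ℝ a b := by
            rcases Sym2.eq_iff.1 hs with ⟨rfl, rfl⟩ | ⟨rfl, rfl⟩
            · exact openSegment_subset_segment ℝ _ _ hx
            · rw [segment_symm]; exact openSegment_subset_segment ℝ _ _ hx
          rw [orient_eq_zero_of_mem_segment hx'] at h1
          exact h1.false
        · have hyo : y ∈ openSegment ℝ q a := mem_openSegment_of_ne_left_right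
            (by rintro rfl; simp at hyβ) hya.symm
            (mem_segment_of_orient (by rwa [← orient_rotate]) hy0 hge.1 hyβ.le)
          refine Set.disjoint_left.1 (hT.prop.2 p r q a hpr haq.symm ?_) hy' hyo
          intro hs
          have hx' : x ∈ segment ℝ q a := by
            rcases Sym2.eq_iff.1 hs with ⟨rfl, rfl⟩ | ⟨rfl, rfl⟩
            · exact openSegment_subset_segment ℝ _ _ hx
            · rw [segment_symm]; exact openSegment_subset_segment ℝ _ _ hx
          rw [orient_eq_zero_of_mem_segment hx'] at h3
          exact h3.false
  rcases le_total (orient b q x) (orient b q p) with h | h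
  · exact main p r hpr hx h
  · refine main r p hpr.symm (by rwa [openSegment_symm]) ?_
    obtain ⟨t, ht0, ht1, rfl⟩ := mem_openSegment_lineMap.1 hx
    rw [orient_lineMap] at h ⊢
    nlinarith

/-- On the side of an edge `a b` of a triangulation on which `a` has a further neighbor `d` such
that the triangle `a b d` lies in the interior of the polygon, there is a triangle `a b w` of the
triangulation; it contains no further vertices. The vertex `w` is the neighbor of `a` that comes
next after `b`. -/
lemma IsTriangulation.exists_triangle (hv : IsSimplePolygon v) (hT : IsTriangulation v T)
    {a b d : ℂ} (hab : T.Adj a b) (had : T.Adj a d) (hD : 0 < orient a b d)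
    (hint : ∀ x, InTriangle a b d x → x ∈ polygonInterior v) :
    ∃ w, T.Adj a w ∧ T.Adj b w ∧ 0 < orient a b w ∧ 0 ≤ orient d a w ∧
      ∀ z ∈ range v, 0 ≤ orient a b z → 0 ≤ orient b w z → 0 ≤ orient w a z →
        z = a ∨ z = b ∨ z = w := by
  have vis := fun {c d} (h : T.Adj c d) => hT.prop.1 h
  obtain ⟨q, ⟨haq, hq1, hq2⟩, hqmax⟩ := Set.exists_max_image
    {q | T.Adj a q ∧ 0 < orient a b q ∧ 0 ≤ orient d a q}
    (fun q => orient d a q / orient a b q)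
    ((Set.finite_range v).subset fun q hq => right_mem_range_of_adj (vis hq.1))
    ⟨d, had, hD, by simp⟩
  have hangle : ∀ r, T.Adj a r → 0 < orient a b r → 0 ≤ orient d a r → ¬ 0 < orient q a r := by
    intro r har h1 h2 h3
    have h := hqmax r ⟨har, h1, h2⟩
    rw [div_le_div_iff₀ h1 hq1] at h
    have : orient a b d * orient q a r =
        orient d a r * orient a b q - orient d a q * orient a b r := by
      simp only [orient]; ring
    nlinarith [mul_pos hD h3]
  -- points of the triangle `a b q` are seen from `a` inside the angle `d a b`
  have hsector : ∀ x, 0 ≤ orient a b x → 0 < orient q a x → 0 < orient d a x := by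
    intro x h1 h2
    have : orient a b q * orient d a x =
        orient a b d * orient q a x + orient d a q * orient a b x := by
      simp only [orient]; ring
    refine pos_of_mul_pos_right (?_ : 0 < orient a b q * orient d a x) hq1.le
    rw [this]
    exact add_pos_of_pos_of_nonneg (mul_pos hD h2) (mul_nonneg hq2 h1)
  have hqV := right_mem_range_of_adj (vis haq)
  set Z : Set ℂ := {z | z ∈ range v ∧ 0 < orient a b z ∧ 0 ≤ orient b q z ∧ 0 ≤ orient q a z}
    with hZ
  have hZfin : Z.Finite := (Set.finite_range v).subset fun z hz => hz.1
  have hqZ : q ∈ Z := ⟨hqV, hq1, by simp, by simp⟩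
  obtain ⟨z₀, hz₀, hz₀max⟩ := Set.exists_max_image Z (fun z => orient b q z / orient a b z)
    hZfin ⟨q, hqZ⟩
  obtain ⟨z, ⟨hz, hzeq⟩, hztie⟩ := Set.exists_min_image
    {z | z ∈ Z ∧ orient b q z / orient a b z = orient b q z₀ / orient a b z₀} (fun z => orient a b z)
    (hZfin.subset fun z hz => hz.1) ⟨z₀, hz₀, rfl⟩
  have hzmax : ∀ w ∈ Z, orient b q w * orient a b z ≤ orient b q z * orient a b w := by
    intro w hw
    have h := hz₀max w hw
    rw [← hzeq, div_le_div_iff₀ hw.2.1 hz.2.1] at h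
    exact h
  have hzq : z = q := by
    by_contra hne
    have hγ : 0 < orient q a z := by
      refine lt_of_le_of_ne hz.2.2.2 fun h0 => ?_
      rcases hv.eq_of_mem_segment (vis haq.symm) hz.1
        (mem_segment_of_orient (by rwa [← orient_rotate]) h0.symm hz.2.1.le hz.2.2.1) with h | h
      · exact hne h
      · have := hz.2.1; rw [h] at this; simp at this
    obtain ⟨x, hx, hxt⟩ := exists_inTriangle_of_angle hD hz.2.1 (hsector z hz.2.1.le hγ)
    have hadj := hT.adj_of_min_angle hv hab haq hq1 hz.1 hz.2.1 hz.2.2.1 hγ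
      (fun w hw h1 h2 h3 => hzmax w ⟨hw, h1, h2, h3⟩) hx (hint x hxt)
    exact hangle z hadj hz.2.1 (hsector z hz.2.1.le hγ).le hγ
  have hempty : ∀ w ∈ range v, 0 ≤ orient a b w → 0 ≤ orient b q w → 0 ≤ orient q a w →
      w = a ∨ w = b ∨ w = q := by
    intro w hw h1 h2 h3
    rcases h1.eq_or_lt with h0 | h1
    · rcases hv.eq_of_mem_segment (vis hab) hw (mem_segment_of_orient hq1 h0.symm h2 h3) with h | h
      · exact Or.inl h
      · exact Or.inr (Or.inl h)
    · have hwZ : w ∈ Z := ⟨hw, h1, h2, h3⟩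
      have hβ := hzmax w hwZ
      rw [hzq, orient_self_right, zero_mul] at hβ
      have hβ0 : orient b q w = 0 := le_antisymm (by
        by_contra! h; exact absurd hβ (not_le.2 (mul_pos h hq1))) h2
      have hα := hztie w ⟨hwZ, by rw [← hzeq, hzq, hβ0, orient_self_right]; simp⟩
      rw [hzq] at hα
      have hsum := orient_sum a b q w
      have hγ0 : orient q a w = 0 := by linarith
      rcases hv.eq_of_mem_segment (vis haq.symm) hw
        (mem_segment_of_orient (by rwa [← orient_rotate]) hγ0 h1.le h2) with h | h
      · exact Or.inr (Or.inr h)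
      · exact Or.inl h
  refine ⟨q, haq, ?_, hq1, hq2, hempty⟩
  by_contra hbq
  have hfree : ∀ p r x, T.Adj p r → x ∈ openSegment ℝ p r → 0 < orient a b x → 0 ≤ orient b q x →
      0 < orient q a x → False := by
    intro p r x hpr hx h1 h2 h3
    refine hT.notMem_triangle_of_empty hv hab haq hbq hq1 hempty ?_ hpr hx h1 h2 h3
    intro r har hr1 hr2
    exact hangle r har hr1 (hsector r hr1.le hr2).le hr2
  have hb := right_mem_range_of_adj (vis hab)
  have hne : b ≠ q := by rintro rfl; simp at hq1
  have hopen : ∀ x ∈ openSegment ℝ b q, 0 < orient a b x ∧ orient b q x = 0 ∧ 0 < orient q a x :=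
    fun x hx => ⟨orient_pos_of_mem_openSegment' hx (by simp) hq1,
      orient_eq_zero_of_mem_segment (openSegment_subset_segment ℝ _ _ hx),
      orient_pos_of_mem_openSegment hx (by rwa [← orient_rotate]) (by simp)⟩
  have hnoV : ∀ w ∈ range v, 0 < orient a b w → 0 ≤ orient b q w → ¬ 0 < orient q a w := by
    intro w hw h1 h2 h3
    rcases hempty w hw h1.le h2 h3.le with rfl | rfl | rfl <;> simp at h1 h3
  obtain ⟨y, hy⟩ : (openSegment ℝ b q).Nonempty := ⟨_, mem_openSegment_lineMap.2
    ⟨1 / 2, by norm_num, by norm_num, rfl⟩⟩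
  obtain ⟨hy1, hy2, hy3⟩ := hopen y hy
  obtain ⟨x, hx, hxt⟩ := exists_inTriangle_of_angle hD hy1 (hsector y hy1.le hy3)
  have hx1 : 0 < orient a b x := hxt.1
  have hx2 : 0 ≤ orient b q x := orient_nonneg_of_mem_segment
    (openSegment_subset_segment ℝ _ _ hx) (by rw [orient_rotate]; exact hq1.le) hy2.ge
  have hx3 : 0 < orient q a x := orient_pos_of_mem_openSegment' hx (by simp) hy3
  refine hbq (hT.adj_of_uncrossed hv hb hqV hne ?_ hy
    (mem_polygonInterior_of_segment (hint x hxt) ?_) ?_)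
  · intro w hw hwo
    obtain ⟨h1, h2, h3⟩ := hopen w hwo
    exact hnoV w hw h1 h2.ge h3
  · rw [Set.disjoint_left]
    intro w hw hwb
    have h1 := orient_pos_of_mem_segment hw hx1 hy1
    have h2 := orient_nonneg_of_mem_segment hw hx2 hy2.ge
    have h3 := orient_pos_of_mem_segment hw hx3 hy3
    rcases mem_polygonBoundary_cases hwb with hr | ⟨i, hi⟩
    · exact hnoV w hr h1 h2 h3
    · exact hfree _ _ w (hT.adj_edge hv i) hi h1 h2 h3
  · intro c d hcd _
    rw [Set.disjoint_left]
    intro w hw hwo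
    obtain ⟨h1, h2, h3⟩ := hopen w hwo
    exact hfree c d w hcd hw h1 h2.ge h3

end

/-! ### Edges of a polygon inside a triangle -/

lemma between_of_orient_eq_zero {a b c : ℂ} (hab : a ≠ b) (hac : a ≠ c) (hbc : b ≠ c)
    (h : orient a b c = 0) :
    c ∈ openSegment ℝ a b ∨ a ∈ openSegment ℝ b c ∨ b ∈ openSegment ℝ c a := by
  have hcol : Collinear ℝ {a, b, c} := by
    obtain ⟨t, ht⟩ := exists_lineMap_eq_of_orient_eq_zero hab h
    rw [collinear_iff_of_mem (p₀ := a) (by simp)]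
    refine ⟨b - a, ?_⟩
    intro p hp
    rcases hp with rfl | rfl | rfl
    · exact ⟨0, by simp⟩
    · exact ⟨1, by simp⟩
    · exact ⟨t, by rw [← ht, AffineMap.lineMap_apply]; rfl⟩
  rcases hcol.wbtw_or_wbtw_or_wbtw with h | h | h
  · exact Or.inr (Or.inr (by
      rw [openSegment_symm]
      exact mem_openSegment_of_ne_left_right hab hbc.symm (mem_segment_iff_wbtw.2 h)))
  · exact Or.inl (by
      rw [openSegment_symm]
      exact mem_openSegment_of_ne_left_right hbc hac (mem_segment_iff_wbtw.2 h))
  · exact Or.inr (Or.inl (by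
      rw [openSegment_symm]
      exact mem_openSegment_of_ne_left_right hac.symm hab.symm (mem_segment_iff_wbtw.2 h)))

lemma eq_of_mem_segment_of_mem_segment {x y z : ℂ} (h1 : x ∈ segment ℝ z y)
    (h2 : z ∈ segment ℝ x y) : x = z := by
  obtain ⟨s, hs0, hs1, hs⟩ := mem_segment_lineMap.1 h1
  obtain ⟨t, ht0, ht1, ht⟩ := mem_segment_lineMap.1 h2
  simp only [AffineMap.lineMap_apply, vsub_eq_sub, vadd_eq_add, Complex.real_smul] at hs ht
  have h : ((t + s * (1 - t) : ℝ) : ℂ) * (y - x) = 0 := by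
    push_cast
    linear_combination hs + (1 - (s : ℂ)) * ht
  rcases mul_eq_zero.1 h with h | h
  · have h : t + s * (1 - t) = 0 := by exact_mod_cast h
    have h3 : 0 ≤ s * (1 - t) := mul_nonneg hs0 (by linarith)
    have h4 : t = 0 := by linarith
    rw [h4] at ht
    simpa using ht
  · rw [h] at ht
    simpa using ht

/-- In a triangle whose sides are pairs of vertices that see each other, an edge of the polygon
can only end at a corner or at a vertex inside the triangle. -/
lemma IsSimplePolygon.inTriangle_of_edge (hv : IsSimplePolygon v) {a b c x y z : ℂ}
    (hab : (visibilityGraph v).Adj a b) (hbc : (visibilityGraph v).Adj b c)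
    (hca : (visibilityGraph v).Adj c a) (hxy : ∃ i, s(x, y) = s(v i, v (finRotate N i)))
    (hz : InTriangle a b c z) (hzs : z ∈ segment ℝ x y) (hya : y ≠ a) (hyb : y ≠ b)
    (hyc : y ≠ c) : InTriangle a b c y := by
  by_contra hy
  obtain ⟨z', hz', hne, hside⟩ := hz.exists_exit hy
  obtain ⟨i, hi⟩ := hxy
  have hseg : segment ℝ x y = segment ℝ (v i) (v (finRotate N i)) := by
    rcases Sym2.eq_iff.1 hi with ⟨rfl, rfl⟩ | ⟨rfl, rfl⟩
    · rfl
    · exact segment_symm ..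
  have hz's : z' ∈ segment ℝ x y :=
    (convex_segment x y).segment_subset hzs (right_mem_segment ℝ x y) hz'
  have hcorner : ∀ w ∈ range v, w ≠ y → z' ≠ w := by
    rintro _ ⟨j, rfl⟩ hwy rfl
    rw [hseg] at hz's
    have hx : v j = x := by
      rcases Sym2.eq_iff.1 hi with ⟨rfl, rfl⟩ | ⟨rfl, rfl⟩ <;>
        rcases hv.eq_of_mem_edge hz's with h | h
      · exact h
      · exact absurd h hwy
      · exact absurd h hwy
      · exact h
    rw [hx] at hz' hne
    exact hne (eq_of_mem_segment_of_mem_segment hz' hzs)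
  have key : ∀ p q, (visibilityGraph v).Adj p q → y ≠ p → y ≠ q → z' ∉ segment ℝ p q := by
    intro p q hpq hp hq hmem
    have h1 := hcorner p (left_mem_range_of_adj hpq) hp.symm
    have h2 := hcorner q (right_mem_range_of_adj hpq) hq.symm
    refine Set.disjoint_left.1 (hv.disjoint_edge hpq i ?_)
      (mem_openSegment_of_ne_left_right h1.symm h2.symm hmem) (hseg ▸ hz's)
    rw [← hi]
    intro hs
    rcases Sym2.eq_iff.1 hs with ⟨-, h⟩ | ⟨-, h⟩
    · exact hq h
    · exact hp h
  rcases hside with h | h | h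
  · exact key a b hab hya hyb h
  · exact key b c hbc hyb hyc h
  · exact key c a hca hyc hya h

/-- Let `y` be a vertex with the incident edges `x y` and `y w` and with an interior diagonal `y a`.
If the angle between `x y` and `y a` has points of the exterior near the edge `x y`,
then the edge `y w` runs inside this angle. The set `D` stands for the open triangle `a x y`. -/
lemma exists_mem_edge_of_sector {a x y w : ℂ} {D : Set ℂ}
    (hya : openSegment ℝ y a ⊆ polygonInterior v)
    (hedge : ∀ i, y ∈ segment ℝ (v i) (v (finRotate N i)) →
      segment ℝ (v i) (v (finRotate N i)) = segment ℝ x y ∨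
      segment ℝ (v i) (v (finRotate N i)) = segment ℝ y w)
    (hD : ∀ s t : ℝ, 0 < s → 0 < t → s + t < 1 → y + s * (a - y) + t * (x - y) ∈ D)
    (hDx : Disjoint D (segment ℝ x y))
    (hext : ∀ q ∈ openSegment ℝ x y, ∀ᶠ z in 𝓝 q, z ∈ D → z ∉ polygonRegion v) :
    ∃ z ∈ segment ℝ y w, z ∈ D := by
  set K : Set ℂ := ⋃ i ∈ {i | y ∉ segment ℝ (v i) (v (finRotate N i))},
    segment ℝ (v i) (v (finRotate N i)) with hK
  have hKc : IsClosed K := (Set.toFinite _).isClosed_biUnion fun i _ => isClosed_segment _ _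
  have hyK : y ∉ K := by
    simp [hK]
  obtain ⟨r, hr, hball⟩ := Metric.isOpen_iff.1 hKc.isOpen_compl y hyK
  set R := ‖a - y‖ + ‖x - y‖ + 1 with hR
  have hRpos : 0 < R := by positivity
  obtain ⟨ε, hε0, hε1, hεr⟩ : ∃ ε : ℝ, 0 < ε ∧ ε < 1 ∧ ε * R < r := by
    refine ⟨min (1 / 2) (r / (2 * R)), by positivity, by
      apply lt_of_le_of_lt (min_le_left _ _); norm_num, ?_⟩
    calc min (1 / 2) (r / (2 * R)) * R ≤ r / (2 * R) * R := by
          gcongr; exact min_le_right _ _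
      _ = r / 2 := by field_simp
      _ < r := by linarith
  set p : ℂ := AffineMap.lineMap y a ε with hp
  set q : ℂ := AffineMap.lineMap y x ε with hq
  have hqo : q ∈ openSegment ℝ x y := by
    rw [openSegment_symm]; exact mem_openSegment_lineMap.2 ⟨ε, hε0, hε1, rfl⟩
  have hpi : p ∈ polygonInterior v := hya (mem_openSegment_lineMap.2 ⟨ε, hε0, hε1, rfl⟩)
  have hform : ∀ z ∈ openSegment ℝ q p, z ∈ D ∧ z ∈ Metric.ball y r := by
    intro z hz
    obtain ⟨t, ht0, ht1, rfl⟩ := mem_openSegment_lineMap.1 hz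
    have hz : (AffineMap.lineMap q p t : ℂ) = y + (ε * t : ℝ) * (a - y)
        + (ε * (1 - t) : ℝ) * (x - y) := by
      simp only [hp, hq, AffineMap.lineMap_apply, vsub_eq_sub, vadd_eq_add, Complex.real_smul]
      push_cast; ring
    have h1t := sub_pos.2 ht1
    rw [hz]
    refine ⟨hD _ _ (by positivity) (by positivity) (by linarith), ?_⟩
    rw [mem_ball_iff_norm, add_assoc, add_sub_cancel_left]
    calc ‖((ε * t : ℝ) : ℂ) * (a - y) + ((ε * (1 - t) : ℝ) : ℂ) * (x - y)‖
        ≤ ε * t * ‖a - y‖ + ε * (1 - t) * ‖x - y‖ := by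
          refine (norm_add_le _ _).trans ?_
          rw [norm_mul, norm_mul, Complex.norm_real, Complex.norm_real,
            Real.norm_of_nonneg (by positivity), Real.norm_of_nonneg (by positivity)]
      _ ≤ ε * 1 * ‖a - y‖ + ε * 1 * ‖x - y‖ := by gcongr; linarith
      _ ≤ ε * R := by rw [hR]; nlinarith
      _ < r := hεr
  obtain ⟨z, hz, hzo⟩ := ((mem_closure_iff_frequently.1
    (segment_subset_closure_openSegment (left_mem_segment ℝ q p))).and_eventually
      (hext q hqo)).exists
  have hzext := hzo (hform z hz).1
  obtain ⟨b, hb, hbb⟩ : ∃ b ∈ segment ℝ p z, b ∈ polygonBoundary v := by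
    by_contra! h
    exact hzext (Or.inr (mem_polygonInterior_of_segment hpi (Set.disjoint_left.2 h)))
  have hbp : b ≠ p := by rintro rfl; exact hpi.1 hbb
  have hbo : b ∈ openSegment ℝ q p := by
    by_cases hbz : b = z
    · rwa [hbz]
    · exact mem_openSegment_trans (by rwa [openSegment_symm] at hz ⊢)
        (by rw [openSegment_symm]; exact mem_openSegment_of_ne_left_right hbp.symm (Ne.symm hbz) hb)
        |> fun h => (openSegment_symm ℝ q p).symm ▸ h
  obtain ⟨hbD, hbr⟩ := hform b hbo
  obtain ⟨i, hi⟩ := mem_iUnion.1 hbb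
  have hyi : y ∈ segment ℝ (v i) (v (finRotate N i)) := by
    by_contra h
    exact hball hbr (mem_biUnion (show i ∈ {i | y ∉ segment ℝ (v i) (v (finRotate N i))} from h) hi)
  rcases hedge i hyi with h | h
  · exact absurd (h ▸ hi) (Set.disjoint_left.1 hDx hbD)
  · exact ⟨b, h ▸ hi, hbD⟩

/-! ### The orientation of a double chain -/

/-- The polygon `v` bounded by a double chain, its vertices being indexed cyclically by
`V : ℤ → ℂ` with period `2 * n`. The blocks `[n * c, n * (c + 1))` of indices are alternately the
vertices of the two chains, so that all statements about a chain and the opposite one become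
statements about a block and the next one. -/
structure IsCyclicDoubleChain (n : ℕ) (v : Fin N → ℂ) (V : ℤ → ℂ) : Prop where
  two_le : 2 ≤ n
  simple : IsSimplePolygon v
  edge : ∀ m, ∃ i, v i = V m ∧ v (finRotate N i) = V (m + 1)
  inj : ∀ i j, V i = V j → |i - j| < 2 * n → i = j
  periodic : ∀ i, V (i + 2 * n) = V i
  exists_eq : ∀ (i : Fin N) (p : ℤ), ∃ m : ℤ, p ≤ m ∧ m < p + 2 * n ∧ v i = V m
  sees : ∀ c x y : ℤ, n * c ≤ x → x < n * c + n → n * c + n ≤ y → y < n * c + 2 * n →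
    (visibilityGraph v).Adj (V x) (V y)

namespace IsCyclicDoubleChain

variable {n : ℕ} {V : ℤ → ℂ}

lemma mem_range (h : IsCyclicDoubleChain n v V) (m : ℤ) : V m ∈ range v := by
  obtain ⟨i, hi, -⟩ := h.edge m
  exact ⟨i, hi⟩

lemma adj_succ (h : IsCyclicDoubleChain n v V) (m : ℤ) :
    (visibilityGraph v).Adj (V m) (V (m + 1)) := by
  obtain ⟨i, hi, hi'⟩ := h.edge m
  rw [← hi, ← hi']
  exact adj_visibilityGraph_edge h.simple i

lemma exists_edge (h : IsCyclicDoubleChain n v V) (m : ℤ) :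
    ∃ i, s(V m, V (m + 1)) = s(v i, v (finRotate N i)) := by
  obtain ⟨i, hi, hi'⟩ := h.edge m
  exact ⟨i, by rw [hi, hi']⟩

/-- The polygon edges at the vertex `V m` lead to the two neighboring indices. -/
lemma edge_at (h : IsCyclicDoubleChain n v V) {i : Fin N} {m : ℤ}
    (hm : V m ∈ segment ℝ (v i) (v (finRotate N i))) :
    (v i = V m ∧ v (finRotate N i) = V (m + 1)) ∨
      (v i = V (m - 1) ∧ v (finRotate N i) = V m) := by
  obtain ⟨j, hj, hj'⟩ := h.edge m
  obtain ⟨k, hk, hk'⟩ := h.edge (m - 1)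
  rw [sub_add_cancel] at hk'
  rw [← hj] at hm
  rcases h.simple.eq_of_mem_edge hm with he | he
  · have := h.simple.injective he
    subst this
    exact Or.inl ⟨hj, hj'⟩
  · rw [hj, ← hk'] at he
    have := (finRotate N).injective (h.simple.injective he)
    subst this
    exact Or.inr ⟨hk, hk'⟩

/-- Vertices that see each other and are not cyclically consecutive span an interior diagonal. -/
lemma openSegment_subset (h : IsCyclicDoubleChain n v V) {x y : ℤ}
    (hxy : (visibilityGraph v).Adj (V x) (V y)) (h1 : V y ≠ V (x + 1)) (h2 : V y ≠ V (x - 1)) :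
    openSegment ℝ (V x) (V y) ⊆ polygonInterior v := by
  rcases hxy.2 with ⟨i, hi⟩ | ⟨-, -, hd⟩
  · exfalso
    rcases Sym2.eq_iff.1 hi with ⟨hx, hy⟩ | ⟨hx, hy⟩
    · rcases h.edge_at (m := x) (i := i) (hx ▸ left_mem_segment ℝ _ _) with ⟨ha, hb⟩ | ⟨ha, hb⟩
      · exact h1 (hy.trans hb)
      · exact hxy.1 (hb.symm.trans hy.symm)
    · rcases h.edge_at (m := x) (i := i) (hx ▸ right_mem_segment ℝ _ _) with ⟨ha, hb⟩ | ⟨ha, hb⟩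
      · exact hxy.1 (ha.symm.trans hy.symm)
      · exact h2 (hy.trans ha)
  · exact hd

/-- A vertex `V a` of a chain lies strictly to the right of the edge from `V k` to `V (k + 1)` of the
opposite chain. It is shown below that this does not happen. -/
def IsBadTriple (n : ℕ) (V : ℤ → ℂ) (c k a : ℤ) : Prop :=
  n * c ≤ k ∧ k + 1 < n * c + n ∧ n * c + n ≤ a ∧ a < n * c + 2 * n ∧
    orient (V k) (V (k + 1)) (V a) < 0

/-- In a bad triangle `V k, V (k + 1), V a` the interior of the polygon is seen from `V (k + 1)`
next to the diagonal to `V a`, but the exterior next to the edge. So the boundary enters the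
triangle at `V (k + 1)`, and it can leave it only through `V a`. -/
lemma IsBadTriple.inTriangle_pred (h : IsCyclicDoubleChain n v V) {c k a : ℤ} (hb : IsBadTriple n V c k a)
    (ha : n * c + n < a) : InTriangle (V (k + 1)) (V k) (V a) (V (a - 1)) := by
  obtain ⟨h1, h2, h3, h4, h5⟩ := hb
  have hne : ∀ i j : ℤ, i ≠ j → i - j < 2 * n → j - i < 2 * n → V i ≠ V j := fun i j hij h1 h2 he =>
    hij (h.inj i j he (abs_lt.2 ⟨by linarith, by linarith⟩))
  have hCB : (visibilityGraph v).Adj (V (k + 1)) (V k) := (h.adj_succ k).symm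
  have hBA : (visibilityGraph v).Adj (V k) (V a) := h.sees c k a h1 (by linarith) h3 h4
  have hAC : (visibilityGraph v).Adj (V a) (V (k + 1)) :=
    (h.sees c (k + 1) a (by linarith) h2 h3 h4).symm
  have hD : 0 < orient (V (k + 1)) (V k) (V a) := by rw [orient_swap]; linarith
  obtain ⟨e, he, he'⟩ := h.edge k
  have hfirst : ∃ z ∈ segment ℝ (V (k + 1)) (V (k + 1 + 1)),
      z ∈ {z | InTriangle (V (k + 1)) (V k) (V a) z} := by
    refine exists_mem_edge_of_sector (v := v) (a := V a) (x := V k) ?_ ?_ ?_ ?_ ?_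
    · refine h.openSegment_subset hAC.symm (hne _ _ ?_ ?_ ?_) (hne _ _ ?_ ?_ ?_) <;> omega
    · intro i hi
      rcases h.edge_at hi with ⟨hx, hy⟩ | ⟨hx, hy⟩
      · exact Or.inr (by rw [hx, hy])
      · rw [add_sub_cancel_right] at hx
        exact Or.inl (by rw [hx, hy])
    · intro s t hs ht hst
      have hlin : ∀ p q, orient p q (V (k + 1) + s * (V a - V (k + 1)) + t * (V k - V (k + 1))) =
          (1 - s - t) * orient p q (V (k + 1)) + s * orient p q (V a) + t * orient p q (V k) := by
        intro p q
        simp [orient]; ring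
      refine ⟨?_, ?_, ?_⟩ <;> rw [hlin]
      · simpa using mul_pos hs hD
      · have : 0 < orient (V k) (V a) (V (k + 1)) := by rwa [orient_rotate]
        simpa using mul_pos (by linarith : 0 < 1 - s - t) this
      · have : 0 < orient (V a) (V (k + 1)) (V k) := by rwa [orient_rotate, orient_rotate]
        simpa using mul_pos ht this
    · rw [Set.disjoint_left]
      intro z hz hz'
      have := hz.1
      rw [segment_symm] at hz'
      rw [orient_eq_zero_of_mem_segment hz'] at this
      exact this.false
    · intro q hq
      have := h.simple.eventually_sides e (y := q) (by rwa [he, he'])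
      rw [he, he'] at this
      filter_upwards [this] with z hz hzD
      refine hz.2 ?_
      rw [orient_swap]
      have := hzD.1
      linarith
  have hall : ∀ m : ℕ, k + 2 + m < a →
      InTriangle (V (k + 1)) (V k) (V a) (V (k + 2 + m)) := by
    intro m
    induction m with
    | zero =>
      intro hm
      obtain ⟨z, hz, hzD⟩ := hfirst
      have hk2 : k + 1 + 1 = k + 2 + ((0 : ℕ) : ℤ) := by push_cast; ring
      rw [hk2] at hz
      refine h.simple.inTriangle_of_edge hCB hBA hAC (hk2 ▸ h.exists_edge (k + 1)) hzD hz
        (hne _ _ ?_ ?_ ?_) (hne _ _ ?_ ?_ ?_) (hne _ _ ?_ ?_ ?_) <;> push_cast at * <;> omega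
    | succ m ih =>
      intro hm
      have hk2 : k + 2 + ((m + 1 : ℕ) : ℤ) = k + 2 + m + 1 := by push_cast; ring
      push_cast at hm
      have := ih (by linarith)
      rw [hk2]
      refine h.simple.inTriangle_of_edge hCB hBA hAC (h.exists_edge _) this
        (left_mem_segment ℝ _ _)
        (hne _ _ ?_ ?_ ?_) (hne _ _ ?_ ?_ ?_) (hne _ _ ?_ ?_ ?_) <;> push_cast at * <;> omega
  have := hall (a - 1 - (k + 2)).toNat (by omega)
  rwa [show k + 2 + ((a - 1 - (k + 2)).toNat : ℤ) = a - 1 by omega] at this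

/-- The counterpart of `IsBadTriple.inTriangle_pred` for the part of the boundary that ends at `V k`. -/
lemma IsBadTriple.inTriangle_succ (h : IsCyclicDoubleChain n v V) {c k a : ℤ} (hb : IsBadTriple n V c k a)
    (ha : a + 1 < n * c + 2 * n) : InTriangle (V (k + 1)) (V k) (V a) (V (a + 1)) := by
  obtain ⟨h1, h2, h3, h4, h5⟩ := hb
  have hne : ∀ i j : ℤ, i ≠ j → i - j < 2 * n → j - i < 2 * n → V i ≠ V j := fun i j hij h1 h2 he =>
    hij (h.inj i j he (abs_lt.2 ⟨by linarith, by linarith⟩))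
  have hCB : (visibilityGraph v).Adj (V (k + 1)) (V k) := (h.adj_succ k).symm
  have hBA : (visibilityGraph v).Adj (V k) (V a) := h.sees c k a h1 (by linarith) h3 h4
  have hAC : (visibilityGraph v).Adj (V a) (V (k + 1)) :=
    (h.sees c (k + 1) a (by linarith) h2 h3 h4).symm
  have hD : 0 < orient (V (k + 1)) (V k) (V a) := by rw [orient_swap]; linarith
  obtain ⟨e, he, he'⟩ := h.edge k
  have hper : V a = V (a - 2 * n) := by rw [← h.periodic (a - 2 * n), sub_add_cancel]
  have hper' : V (a + 1) = V (a + 1 - 2 * n) := by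
    rw [← h.periodic (a + 1 - 2 * n), sub_add_cancel]
  have hedge' : ∀ m, ∃ i, s(V m, V (m - 1)) = s(v i, v (finRotate N i)) := by
    intro m
    have := h.exists_edge (m - 1)
    rw [sub_add_cancel] at this
    rwa [Sym2.eq_swap]
  have hfirst : ∃ z ∈ segment ℝ (V k) (V (k - 1)),
      z ∈ {z | InTriangle (V (k + 1)) (V k) (V a) z} := by
    refine exists_mem_edge_of_sector (v := v) (a := V a) (x := V (k + 1)) ?_ ?_ ?_ ?_ ?_
    · refine h.openSegment_subset hBA (hne _ _ ?_ ?_ ?_) ?_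
      · omega
      · omega
      · omega
      · rw [hper]
        refine hne _ _ ?_ ?_ ?_ <;> omega
    · intro i hi
      rcases h.edge_at hi with ⟨hx, hy⟩ | ⟨hx, hy⟩
      · exact Or.inl (by rw [hx, hy, segment_symm])
      · exact Or.inr (by rw [hx, hy, segment_symm])
    · intro s t hs ht hst
      have hlin : ∀ p q, orient p q (V k + s * (V a - V k) + t * (V (k + 1) - V k)) =
          (1 - s - t) * orient p q (V k) + s * orient p q (V a) + t * orient p q (V (k + 1)) := by
        intro p q
        simp [orient]; ring
      refine ⟨?_, ?_, ?_⟩ <;> rw [hlin]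
      · simpa using mul_pos hs hD
      · have : 0 < orient (V k) (V a) (V (k + 1)) := by rwa [orient_rotate]
        simpa using mul_pos ht this
      · have : 0 < orient (V a) (V (k + 1)) (V k) := by rwa [orient_rotate, orient_rotate]
        simpa using mul_pos (by linarith : 0 < 1 - s - t) this
    · rw [Set.disjoint_left]
      intro z hz hz'
      have := hz.1
      rw [orient_eq_zero_of_mem_segment hz'] at this
      exact this.false
    · intro q hq
      rw [openSegment_symm] at hq
      have := h.simple.eventually_sides e (y := q) (by rwa [he, he'])
      rw [he, he'] at this
      filter_upwards [this] with z hz hzD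
      refine hz.2 ?_
      rw [orient_swap]
      have := hzD.1
      linarith
  have hall : ∀ m : ℕ, a - 2 * n < k - 1 - m →
      InTriangle (V (k + 1)) (V k) (V a) (V (k - 1 - m)) := by
    intro m
    induction m with
    | zero =>
      intro hm
      obtain ⟨z, hz, hzD⟩ := hfirst
      have hk2 : k - 1 = k - 1 - ((0 : ℕ) : ℤ) := by push_cast; ring
      have hed := hedge' k
      rw [hk2] at hz hed
      refine h.simple.inTriangle_of_edge hCB hBA hAC hed hzD hz
        (hne _ _ ?_ ?_ ?_) (hne _ _ ?_ ?_ ?_) (hper ▸ hne _ _ ?_ ?_ ?_) <;> push_cast at * <;> omega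
    | succ m ih =>
      intro hm
      have hk2 : k - 1 - ((m + 1 : ℕ) : ℤ) = k - 1 - m - 1 := by push_cast; ring
      push_cast at hm
      have := ih (by linarith)
      rw [hk2]
      refine h.simple.inTriangle_of_edge hCB hBA hAC (hedge' _) this
        (left_mem_segment ℝ _ _)
        (hne _ _ ?_ ?_ ?_) (hne _ _ ?_ ?_ ?_) (hper ▸ hne _ _ ?_ ?_ ?_) <;> push_cast at * <;> omega
  have := hall (k - 1 - (a + 1 - 2 * n)).toNat (by omega)
  rw [show k - 1 - ((k - 1 - (a + 1 - 2 * n)).toNat : ℤ) = a + 1 - 2 * n by omega] at this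
  rwa [hper']

/-- Every bad triangle contains a smaller one. -/
lemma IsBadTriple.exists_smaller (h : IsCyclicDoubleChain n v V) {c k a : ℤ} (hb : IsBadTriple n V c k a) :
    ∃ c' k' a', IsBadTriple n V c' k' a' ∧
      orient (V k) (V (k + 1)) (V a) < orient (V k') (V (k' + 1)) (V a') := by
  have hn := h.two_le
  have hs := fun x => orient_sum (V (k + 1)) (V k) (V a) x
  have hsw := orient_swap (V k) (V (k + 1)) (V a)
  by_cases ha : n * c + n < a
  · obtain ⟨t1, t2, t3⟩ := hb.inTriangle_pred h ha
    obtain ⟨h1, h2, h3, h4, h5⟩ := hb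
    have e : orient (V (a - 1)) (V a) (V (k + 2 * n)) = -orient (V k) (V a) (V (a - 1)) := by
      rw [h.periodic]; simp only [orient]; ring
    refine ⟨c + 1, a - 1, k + 2 * n, ⟨?_, ?_, ?_, ?_, ?_⟩, ?_⟩
    · linarith [mul_add (n : ℤ) c 1]
    · linarith [mul_add (n : ℤ) c 1]
    · linarith [mul_add (n : ℤ) c 1]
    · linarith [mul_add (n : ℤ) c 1]
    · rw [sub_add_cancel, e]; linarith
    · rw [sub_add_cancel, e]; linarith [hs (V (a - 1))]
  · have ha' : a + 1 < n * c + 2 * n := by have := hb.2.2.1; omega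
    obtain ⟨t1, t2, t3⟩ := hb.inTriangle_succ h ha'
    obtain ⟨h1, h2, h3, h4, h5⟩ := hb
    have e : orient (V a) (V (a + 1)) (V (k + 1 + 2 * n)) =
        -orient (V a) (V (k + 1)) (V (a + 1)) := by
      rw [h.periodic]; simp only [orient]; ring
    refine ⟨c + 1, a, k + 1 + 2 * n, ⟨?_, ?_, ?_, ?_, ?_⟩, ?_⟩
    · linarith [mul_add (n : ℤ) c 1]
    · linarith [mul_add (n : ℤ) c 1]
    · linarith [mul_add (n : ℤ) c 1]
    · linarith [mul_add (n : ℤ) c 1]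
    · rw [e]; linarith
    · rw [e]; linarith [hs (V (a + 1))]

/-- Each chain lies to the left of all edges of the opposite chain. -/
lemma orient_succ_pos (h : IsCyclicDoubleChain n v V) {c k a : ℤ} (h1 : n * c ≤ k)
    (h2 : k + 1 < n * c + n) (h3 : n * c + n ≤ a) (h4 : a < n * c + 2 * n) :
    0 < orient (V k) (V (k + 1)) (V a) := by
  have hnot : ∀ c k a, ¬ IsBadTriple n V c k a := by
    intro c k a hb
    have hfin : {x : ℂ × ℂ × ℂ | ∃ c k a, IsBadTriple n V c k a ∧ x = (V k, V (k + 1), V a)}.Finite := by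
      refine ((finite_range v).prod ((finite_range v).prod (finite_range v))).subset ?_
      rintro _ ⟨c, k, a, -, rfl⟩
      exact ⟨h.mem_range _, h.mem_range _, h.mem_range _⟩
    obtain ⟨x, ⟨c, k, a, hb, rfl⟩, hmax⟩ := Set.exists_max_image _
      (fun x : ℂ × ℂ × ℂ => orient x.1 x.2.1 x.2.2) hfin ⟨_, c, k, a, hb, rfl⟩
    obtain ⟨c', k', a', hb', hlt⟩ := hb.exists_smaller h
    exact absurd (hmax _ ⟨c', k', a', hb', rfl⟩) (not_le.2 hlt)
  have hge : 0 ≤ orient (V k) (V (k + 1)) (V a) := by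
    by_contra! hlt
    exact hnot c k a ⟨h1, h2, h3, h4, hlt⟩
  refine lt_of_le_of_ne hge fun h0 => ?_
  have hBC := h.adj_succ k
  have hBA := h.sees c k a h1 (by linarith) h3 h4
  have hCA := h.sees c (k + 1) a (by linarith) h2 h3 h4
  rcases between_of_orient_eq_zero hBC.1 hBA.1 hCA.1 h0.symm with hh | hh | hh
  · exact h.simple.notMem_openSegment hBC (h.mem_range _) hh
  · exact h.simple.notMem_openSegment hCA (h.mem_range _) hh
  · exact h.simple.notMem_openSegment hBA.symm (h.mem_range _) hh

/-- From every vertex the opposite chain is seen in angular order, under an angle less than `π`: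
it lies on one side of an edge at the vertex. -/
lemma orient_pos (h : IsCyclicDoubleChain n v V) {c k k' a : ℤ} (h1 : n * c ≤ k) (hk : k < k')
    (h2 : k' < n * c + n) (h3 : n * c + n ≤ a) (h4 : a < n * c + 2 * n) :
    0 < orient (V k) (V k') (V a) := by
  have hn := h.two_le
  obtain ⟨e, s, hs, he⟩ : ∃ e : ℂ, ∃ s : ℝ, s ≠ 0 ∧ ∀ x : ℤ, n * c ≤ x → x < n * c + n →
      0 < s * orient (V a) e (V x) := by
    by_cases ha : a + 1 < n * c + 2 * n
    · refine ⟨V (a + 1), 1, one_ne_zero, fun x hx hx' => ?_⟩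
      have := h.orient_succ_pos (c := c + 1) (k := a) (a := x + 2 * n)
        (by linarith [mul_add (n : ℤ) c 1]) (by linarith [mul_add (n : ℤ) c 1])
        (by linarith [mul_add (n : ℤ) c 1]) (by linarith [mul_add (n : ℤ) c 1])
      rw [h.periodic] at this
      linarith
    · refine ⟨V (a - 1), -1, by norm_num, fun x hx hx' => ?_⟩
      have := h.orient_succ_pos (c := c + 1) (k := a - 1) (a := x + 2 * n)
        (by rw [mul_add, mul_one]; omega) (by linarith [mul_add (n : ℤ) c 1])
        (by linarith [mul_add (n : ℤ) c 1]) (by linarith [mul_add (n : ℤ) c 1])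
      rw [h.periodic, sub_add_cancel, orient_swap] at this
      linarith
  obtain ⟨m, rfl⟩ : ∃ m : ℕ, k' = k + 1 + m := ⟨(k' - k - 1).toNat, by omega⟩
  induction m with
  | zero =>
    have := h.orient_succ_pos h1 (by simpa using h2) h3 h4
    simpa using this
  | succ m ih =>
    push_cast at h2 hk ⊢
    have ih := ih (by omega) (by omega)
    have hstep := h.orient_succ_pos (k := k + 1 + m) (by omega) (by omega) h3 h4
    rw [← add_assoc (k + 1)]
    rw [← orient_rotate, ← orient_rotate] at ih hstep ⊢
    have hp := orient_pluecker (V a) e (V k) (V (k + 1 + m)) (V (k + 1 + m + 1))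
    have ex := mul_pos (he k h1 (by omega)) hstep
    have ez := mul_pos (he (k + 1 + m + 1) (by omega) (by omega)) ih
    have ey := he (k + 1 + m) (by omega) (by omega)
    refine pos_of_mul_pos_right (?_ : 0 < s * orient (V a) e (V (k + 1 + m)) *
      orient (V a) (V k) (V (k + 1 + m + 1))) ey.le
    have e' : s * orient (V a) e (V (k + 1 + m)) * orient (V a) (V k) (V (k + 1 + m + 1)) =
        s * orient (V a) e (V k) * orient (V a) (V (k + 1 + m)) (V (k + 1 + m + 1)) +
        s * orient (V a) e (V (k + 1 + m + 1)) * orient (V a) (V k) (V (k + 1 + m)) := by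
      linear_combination (-s) * hp
    rw [e']
    exact add_pos ex ez

/-- The triangles spanned by an edge of a chain and a vertex of the opposite chain contain no
further vertices. -/
lemma notMem_triangle (h : IsCyclicDoubleChain n v V) {c k a : ℤ} (h1 : n * c ≤ k)
    (h2 : k + 1 < n * c + n) (h3 : n * c + n ≤ a) (h4 : a < n * c + 2 * n) {x : ℂ}
    (hx : x ∈ range v) : ¬ InTriangle (V k) (V (k + 1)) (V a) x := by
  rintro ⟨t1, t2, t3⟩
  obtain ⟨i, rfl⟩ := hx
  obtain ⟨m, hm1, hm2, hm⟩ := h.exists_eq i (n * c)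
  rw [hm] at t1 t2 t3
  rcases lt_or_ge m (n * c + n) with hmn | hmn
  · rcases lt_trichotomy m k with hlt | rfl | hlt
    · have := h.orient_pos hm1 hlt (by linarith) h3 h4
      have e : orient (V a) (V k) (V m) = -orient (V m) (V k) (V a) := by
        simp only [orient]; ring
      linarith
    · simp at t3
    · rcases (Int.add_one_le_iff.2 hlt).eq_or_lt with rfl | hlt
      · simp at t1
      · have := h.orient_pos (by linarith) hlt hmn h3 h4
        rw [orient_swap_right] at this
        linarith
  · rcases lt_trichotomy m a with hlt | rfl | hlt
    · have := h.orient_pos (c := c + 1) (k := m) (k' := a) (a := k + 1 + 2 * n)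
        (by linarith [mul_add (n : ℤ) c 1]) hlt (by linarith [mul_add (n : ℤ) c 1])
        (by linarith [mul_add (n : ℤ) c 1]) (by linarith [mul_add (n : ℤ) c 1])
      rw [h.periodic] at this
      have e : orient (V (k + 1)) (V a) (V m) = -orient (V m) (V a) (V (k + 1)) := by
        simp only [orient]; ring
      linarith
    · simp at t2
    · have := h.orient_pos (c := c + 1) (k := a) (k' := m) (a := k + 2 * n)
        (by linarith [mul_add (n : ℤ) c 1]) hlt (by linarith [mul_add (n : ℤ) c 1])
        (by linarith [mul_add (n : ℤ) c 1]) (by linarith [mul_add (n : ℤ) c 1])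
      rw [h.periodic, orient_swap_right] at this
      linarith

/-- The triangles spanned by an edge of a chain and a vertex of the opposite chain lie in the
polygon: the boundary does not enter them, and they lie to the left of an edge. -/
lemma inTriangle_subset_interior (h : IsCyclicDoubleChain n v V) {c k a : ℤ} (h1 : n * c ≤ k)
    (h2 : k + 1 < n * c + n) (h3 : n * c + n ≤ a) (h4 : a < n * c + 2 * n) {x : ℂ}
    (hx : InTriangle (V k) (V (k + 1)) (V a) x) : x ∈ polygonInterior v := by
  have hBC := h.adj_succ k
  have hBA := h.sees c k a h1 (by linarith) h3 h4
  have hCA := h.sees c (k + 1) a (by linarith) h2 h3 h4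
  have hoff : ∀ z, InTriangle (V k) (V (k + 1)) (V a) z → z ∉ polygonBoundary v := by
    intro z hz hzb
    obtain ⟨i, hi⟩ := mem_iUnion.1 hzb
    have hcorner : ∀ p q, s(p, q) = s(v i, v (finRotate N i)) → q ∈ range v →
        z ∈ segment ℝ p q → q = V k ∨ q = V (k + 1) ∨ q = V a := by
      intro p q hpq hq hzs
      by_contra! hne
      exact h.notMem_triangle h1 h2 h3 h4 hq (h.simple.inTriangle_of_edge hBC hCA hBA.symm
        ⟨i, hpq⟩ hz hzs hne.1 hne.2.1 hne.2.2)
    have c1 := hcorner _ _ rfl (mem_range_self _) hi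
    have c2 := hcorner _ _ Sym2.eq_swap (mem_range_self _) (segment_symm ℝ (v i) _ ▸ hi)
    obtain ⟨t1, t2, t3⟩ := hz
    have hzero : orient (V k) (V (k + 1)) z ≤ 0 ∨ orient (V (k + 1)) (V a) z ≤ 0 ∨
        orient (V a) (V k) z ≤ 0 := by
      have hsame : v i ≠ v (finRotate N i) := h.simple.ne_finRotate i
      rcases c1 with c1 | c1 | c1 <;> rcases c2 with c2 | c2 | c2 <;> rw [c1, c2] at hi hsame
      · exact absurd rfl hsame
      · exact Or.inl (orient_eq_zero_of_mem_segment (segment_symm ℝ (V k) _ ▸ hi)).le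
      · exact Or.inr (Or.inr (orient_eq_zero_of_mem_segment hi).le)
      · exact Or.inl (orient_eq_zero_of_mem_segment hi).le
      · exact absurd rfl hsame
      · exact Or.inr (Or.inl (orient_eq_zero_of_mem_segment (segment_symm ℝ (V a) _ ▸ hi)).le)
      · exact Or.inr (Or.inr (orient_eq_zero_of_mem_segment (segment_symm ℝ (V k) _ ▸ hi)).le)
      · exact Or.inr (Or.inl (orient_eq_zero_of_mem_segment hi).le)
      · exact absurd rfl hsame
    rcases hzero with h | h | h <;> linarith
  obtain ⟨e, he, he'⟩ := h.edge k
  have hD := hx.orient_pos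
  -- a point of the triangle close to the edge
  set q : ℂ := AffineMap.lineMap (V k) (V (k + 1)) (1 / 2 : ℝ) with hq
  have hqo : q ∈ openSegment ℝ (V k) (V (k + 1)) :=
    mem_openSegment_lineMap.2 ⟨1 / 2, by norm_num, by norm_num, rfl⟩
  have hev := h.simple.eventually_sides e (y := q) (by rwa [he, he'])
  rw [he, he'] at hev
  obtain ⟨z, hz, hzi⟩ := ((mem_closure_iff_frequently.1
    (segment_subset_closure_openSegment (left_mem_segment ℝ q x))).and_eventually hev).exists
  have hq1 := orient_eq_zero_of_mem_segment (openSegment_subset_segment ℝ _ _ hqo)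
  have hq2 : 0 < orient (V (k + 1)) (V a) q := orient_pos_of_mem_openSegment hqo
    (by rwa [orient_rotate]) (by simp)
  have hq3 : 0 < orient (V a) (V k) q := orient_pos_of_mem_openSegment' hqo (by simp)
    (by rwa [← orient_rotate])
  have hzt : InTriangle (V k) (V (k + 1)) (V a) z :=
    ⟨orient_pos_of_mem_openSegment' hz hq1.ge hx.1, orient_pos_of_mem_openSegment hz hq2 hx.2.1.le,
      orient_pos_of_mem_openSegment hz hq3 hx.2.2.le⟩
  refine mem_polygonInterior_of_segment (hzi.1 hzt.1) (Set.disjoint_left.2 fun w hw => ?_)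
  exact hoff w (hzt.of_mem_segment hx hw)

end IsCyclicDoubleChain

/-! ### Cyclic indexing and the shape of the chains -/

lemma coe_finRotate_zpow (m : ℕ) (k : ℤ) (i : Fin (m + 1)) :
    ((((finRotate (m + 1)) ^ k) i).val : ℤ) = (i.val + k) % (m + 1 : ℕ) := by
  have hstep : ∀ j : Fin (m + 1),
      ((finRotate (m + 1) j).val : ℤ) = ((j.val : ℤ) + 1) % (m + 1 : ℕ) := by
    intro j
    rw [coe_finRotate]
    split_ifs with h
    · subst h; simp
    · have : j.val < m := by
        have := j.isLt
        have h' : j.val ≠ m := fun h' => h (Fin.ext (by simpa using h'))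
        omega
      rw [Int.emod_eq_of_lt (by positivity) (by push_cast; omega)]
      push_cast; rfl
  induction k using Int.induction_on with
  | zero =>
    have := i.isLt
    rw [Int.emod_eq_of_lt (by positivity) (by push_cast; omega)]
    simp
  | succ k ih =>
    rw [add_comm (k : ℤ) 1, zpow_one_add, Equiv.Perm.mul_apply, hstep, ih, Int.emod_add_emod]
    ring_nf
  | pred k ih =>
    have h : (finRotate (m + 1) ^ (-(k : ℤ))) i =
        finRotate (m + 1) ((finRotate (m + 1) ^ (-(k : ℤ) - 1)) i) := by
      rw [← Equiv.Perm.mul_apply, ← zpow_one_add]; congr 2; ring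
    rw [h, hstep] at ih
    set j := (finRotate (m + 1) ^ (-(k : ℤ) - 1)) i with hj
    have hmod : (j.val : ℤ) ≡ i.val + (-(k : ℤ) - 1) [ZMOD (m + 1 : ℕ)] := by
      refine Int.ModEq.add_right_cancel' 1 ?_
      have e : (i.val : ℤ) + (-(k : ℤ) - 1) + 1 = i.val + -(k : ℤ) := by ring
      rw [e]
      exact ih
    rw [← hmod]
    have := j.isLt
    exact (Int.emod_eq_of_lt (by positivity) (by push_cast; omega)).symm

/-- The vertices of the polygon bounded by a double chain, indexed cyclically: `u n, …, u 1` have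
the indices `0, …, n - 1`, and `l 1, …, l n` have the indices `n, …, 2 * n - 1`. -/
def chainVertex (n : ℕ) (u l : ℕ → ℂ) (k : ℤ) : ℂ :=
  if k % (2 * n) < n then u (n - (k % (2 * n)).toNat) else l ((k % (2 * n)).toNat - n + 1)

variable {n : ℕ} {u l : ℕ → ℂ}

lemma chainVertex_upper (c : ℤ) {i : ℕ} (h1 : 1 ≤ i) (h2 : i ≤ n) :
    chainVertex n u l (n - i + 2 * n * c) = u i := by
  have : ((n : ℤ) - i + 2 * n * c) % (2 * n) = n - i := by
    rw [Int.add_mul_emod_self_left]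
    exact Int.emod_eq_of_lt (by omega) (by omega)
  rw [chainVertex, this, if_pos (by omega)]
  congr 1
  omega

lemma chainVertex_lower (c : ℤ) {j : ℕ} (h1 : 1 ≤ j) (h2 : j ≤ n) :
    chainVertex n u l (n + j - 1 + 2 * n * c) = l j := by
  have : ((n : ℤ) + j - 1 + 2 * n * c) % (2 * n) = n + j - 1 := by
    rw [Int.add_mul_emod_self_left]
    exact Int.emod_eq_of_lt (by omega) (by omega)
  rw [chainVertex, this, if_neg (by omega)]
  congr 1
  omega

lemma chainPolygon_zpow (hn : 1 ≤ n) (k : ℤ) :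
    chainPolygon n u l ((finRotate (2 * n) ^ k) ⟨0, by omega⟩) = chainVertex n u l k := by
  have h : (((finRotate (2 * n) ^ k) ⟨0, by omega⟩ : Fin (2 * n)).val : ℤ) = k % (2 * n) := by
    obtain ⟨m, hm⟩ : ∃ m, 2 * n = m + 1 := ⟨2 * n - 1, by omega⟩
    have h := coe_finRotate_zpow m k ⟨0, by omega⟩
    have e : (2 * (n : ℤ)) = ((m + 1 : ℕ) : ℤ) := by exact_mod_cast hm
    rw [e]
    simp only [CharP.cast_eq_zero, zero_add] at h
    rw [← h]
    have : ∀ (a b : ℕ) (hab : a = b) (ha : 0 < a) (hb : 0 < b),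
        ((finRotate a ^ k) ⟨0, ha⟩).val = ((finRotate b ^ k) ⟨0, hb⟩).val := by
      rintro a _ rfl _ _; rfl
    exact_mod_cast this _ _ hm _ _
  have hval : ((finRotate (2 * n) ^ k) ⟨0, by omega⟩ : Fin (2 * n)).val = (k % (2 * n)).toNat := by
    omega
  have hnn : 0 ≤ k % (2 * (n : ℤ)) := Int.emod_nonneg _ (by omega)
  rw [chainPolygon, chainVertex, hval]
  congr 1
  rw [eq_iff_iff]
  omega

lemma IsDoubleChain.isCyclicDoubleChain (h : IsDoubleChain n u l) :
    IsCyclicDoubleChain n (chainPolygon n u l) (chainVertex n u l) := by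
  have hn := h.two_le
  have hpoly := fun k => chainPolygon_zpow (u := u) (l := l) (show 1 ≤ n by omega) k
  have hper : ∀ k t : ℤ, chainVertex n u l (k + 2 * n * t) = chainVertex n u l k := by
    intro k t
    simp only [chainVertex, Int.add_mul_emod_self_left]
  have hval : ∀ (j : Fin (2 * n)) (k : ℤ), (j.val : ℤ) = k % (2 * n) →
      chainPolygon n u l j = chainVertex n u l k := by
    intro j k hj
    have hj' : j.val = (k % (2 * n)).toNat := by omega
    rw [chainPolygon, chainVertex, hj']
    have hnn : 0 ≤ k % (2 * (n : ℤ)) := Int.emod_nonneg _ (by omega)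
    congr 1
    rw [eq_iff_iff]
    omega
  refine ⟨hn, h.simple, ?_, ?_, ?_, ?_, ?_⟩
  · intro m
    refine ⟨(finRotate (2 * n) ^ m) ⟨0, by omega⟩, hpoly m, ?_⟩
    rw [← hpoly (m + 1), add_comm m 1, zpow_one_add, Equiv.Perm.mul_apply]
  · intro i j hij hlt
    have hex : ∀ k : ℤ, ∃ f : Fin (2 * n), (f.val : ℤ) = k % (2 * n) := fun k =>
      ⟨⟨(k % (2 * n)).toNat, by
        have := Int.emod_lt_of_pos k (show 0 < 2 * (n : ℤ) by omega); omega⟩, by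
        have := Int.emod_nonneg k (show 2 * (n : ℤ) ≠ 0 by omega); simpa using this⟩
    obtain ⟨f, hf⟩ := hex i
    obtain ⟨g, hg⟩ := hex j
    rw [← hval f i hf, ← hval g j hg] at hij
    have := h.simple.injective hij
    subst this
    rw [hf] at hg
    have hdvd : (2 * (n : ℤ)) ∣ i - j :=
      (show j ≡ i [ZMOD 2 * n] from hg.symm).dvd
    have := Int.eq_zero_of_abs_lt_dvd hdvd hlt
    linarith
  · intro i
    simpa using hper i 1
  · intro i p
    refine ⟨p + ((i.val : ℤ) - p) % (2 * n), ?_, ?_, ?_⟩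
    · have := Int.emod_nonneg ((i.val : ℤ) - p) (show 2 * (n : ℤ) ≠ 0 by omega)
      linarith
    · have := Int.emod_lt_of_pos ((i.val : ℤ) - p) (show 0 < 2 * (n : ℤ) by omega)
      linarith
    · refine hval i _ ?_
      rw [Int.add_emod_emod, add_sub_cancel, Int.emod_eq_of_lt (by positivity)]
      exact_mod_cast i.isLt
  · intro c x y h1 h2 h3 h4
    rcases Int.even_or_odd' c with ⟨t, rfl | rfl⟩
    · have e : (n : ℤ) * (2 * t) = 2 * n * t := by ring
      rw [e] at h1 h2 h3 h4
      have hx := chainVertex_upper (n := n) (u := u) (l := l) t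
        (i := (n - (x - 2 * n * t)).toNat) (by omega) (by omega)
      have hy := chainVertex_lower (n := n) (u := u) (l := l) t
        (j := ((y - 2 * n * t) - n + 1).toNat) (by omega) (by omega)
      rw [show (n : ℤ) - ((n - (x - 2 * n * t)).toNat : ℤ) + 2 * n * t = x by omega] at hx
      rw [show (n : ℤ) + (((y - 2 * n * t) - n + 1).toNat : ℤ) - 1 + 2 * n * t = y by omega] at hy
      rw [hx, hy]
      exact h.sees _ ⟨by omega, by omega⟩ _ ⟨by omega, by omega⟩
    · have e : (n : ℤ) * (2 * t + 1) = 2 * n * t + n := by ring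
      rw [e] at h1 h2 h3 h4
      have hx := chainVertex_lower (n := n) (u := u) (l := l) t
        (j := ((x - 2 * n * t) - n + 1).toNat) (by omega) (by omega)
      have hy := chainVertex_upper (n := n) (u := u) (l := l) (t + 1)
        (i := (n - (y - 2 * n * t - 2 * n)).toNat) (by omega) (by omega)
      rw [show (n : ℤ) + (((x - 2 * n * t) - n + 1).toNat : ℤ) - 1 + 2 * n * t = x by omega] at hx
      have e2 : 2 * (n : ℤ) * (t + 1) = 2 * n * t + 2 * n := by ring
      rw [e2, show (n : ℤ) - ((n - (y - 2 * n * t - 2 * n)).toNat : ℤ) + (2 * n * t + 2 * n) = y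
        by omega] at hy
      rw [hx, hy]
      exact (h.sees _ ⟨by omega, by omega⟩ _ ⟨by omega, by omega⟩).symm

/-- Four points are in convex position if each diagonal separates the other two points. -/
lemma convexIndependent_of_orient {a b c d : ℂ} {s : ℝ} (h1 : 0 < s * orient a b c)
    (h2 : 0 < s * orient b c d) (h3 : 0 < s * orient c d a) (h4 : 0 < s * orient d a b) :
    ConvexIndependent ℝ ![a, b, c, d] := by
  rw [convexIndependent_iff_notMem_convexHull_sdiff]
  -- a half plane that contains the other points, but not the one in question
  have key : ∀ (p q x : ℂ) (r : ℝ) (S : Set ℂ), r * orient p q x < 0 →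
      (∀ y ∈ S, 0 ≤ r * orient p q y) → x ∉ convexHull ℝ S := by
    intro p q x r S hx hS hmem
    have hconv : Convex ℝ {y | 0 ≤ r * orient p q y} := by
      rw [convex_iff_segment_subset]
      intro y hy z hz w hw
      obtain ⟨t, h0, h1, rfl⟩ := mem_segment_lineMap.1 hw
      simp only [mem_ofPred_eq, orient_lineMap] at hy hz ⊢
      nlinarith [mul_nonneg (sub_nonneg.2 h1) hy, mul_nonneg h0 hz]
    have := convexHull_min hS hconv hmem
    exact absurd this (not_le.2 hx)
  have r1 : orient a c d = orient c d a := (orient_rotate ..).symm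
  have r2 : orient a c b = -orient a b c := orient_swap_right ..
  have r3 : orient b d a = orient d a b := (orient_rotate ..).symm
  have r4 : orient b d c = -orient b c d := orient_swap_right ..
  intro i S
  have hS : ∀ y ∈ (![a, b, c, d] '' (S \ {i})), ∃ j, j ≠ i ∧ ![a, b, c, d] j = y := by
    rintro _ ⟨j, hj, rfl⟩
    exact ⟨j, hj.2, rfl⟩
  fin_cases i
  · refine key b d _ (-s) _ (by simp [r3]; exact h4) fun y hy => ?_
    obtain ⟨j, hj, rfl⟩ := hS y hy
    fin_cases j <;> simp_all
    linarith
  · refine key a c _ s _ (by simp [r2]; exact h1) fun y hy => ?_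
    obtain ⟨j, hj, rfl⟩ := hS y hy
    fin_cases j <;> simp_all
    linarith
  · refine key b d _ s _ (by simp [r4]; exact h2) fun y hy => ?_
    obtain ⟨j, hj, rfl⟩ := hS y hy
    fin_cases j <;> simp_all
    linarith
  · refine key a c _ (-s) _ (by simp [r1]; exact h3) fun y hy => ?_
    obtain ⟨j, hj, rfl⟩ := hS y hy
    fin_cases j <;> simp_all
    linarith

namespace IsDoubleChain

lemma orient_upper_pos (h : IsDoubleChain n u l) {i k m : ℕ} (hi : 1 ≤ i) (hik : i < k)
    (hk : k ≤ n) (hm : 1 ≤ m) (hm' : m ≤ n) : 0 < orient (u k) (u i) (l m) := by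
  rw [← chainVertex_upper (n := n) (u := u) (l := l) 0 hi (by omega),
    ← chainVertex_upper (n := n) (u := u) (l := l) 0 (by omega) hk,
    ← chainVertex_lower (n := n) (u := u) (l := l) 0 hm hm']
  exact h.isCyclicDoubleChain.orient_pos (c := 0) (by omega) (by omega) (by omega) (by omega)
    (by omega)

lemma orient_lower_pos (h : IsDoubleChain n u l) {i k m : ℕ} (hi : 1 ≤ i) (hik : i < k)
    (hk : k ≤ n) (hm : 1 ≤ m) (hm' : m ≤ n) : 0 < orient (l i) (l k) (u m) := by
  rw [← chainVertex_lower (n := n) (u := u) (l := l) 0 hi (by omega),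
    ← chainVertex_lower (n := n) (u := u) (l := l) 0 (by omega) hk,
    ← chainVertex_upper (n := n) (u := u) (l := l) 1 hm hm']
  exact h.isCyclicDoubleChain.orient_pos (c := 1) (by omega) (by omega) (by omega) (by omega)
    (by omega)

lemma inTriangle_upper (h : IsDoubleChain n u l) {i m : ℕ} (hi : 1 ≤ i) (hin : i < n)
    (hm : 1 ≤ m) (hm' : m ≤ n) {x : ℂ} (hx : InTriangle (u (i + 1)) (u i) (l m) x) :
    x ∈ polygonInterior (chainPolygon n u l) := by
  rw [← chainVertex_upper (n := n) (u := u) (l := l) 0 hi (by omega),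
    ← chainVertex_upper (n := n) (u := u) (l := l) 0 (i := i + 1) (by omega) hin,
    ← chainVertex_lower (n := n) (u := u) (l := l) 0 hm hm',
    show (n : ℤ) - i + 2 * n * 0 = n - (i + 1 : ℕ) + 2 * n * 0 + 1 by push_cast; ring] at hx
  exact h.isCyclicDoubleChain.inTriangle_subset_interior (c := 0) (by omega) (by omega) (by omega)
    (by omega) hx

lemma inTriangle_lower (h : IsDoubleChain n u l) {i m : ℕ} (hi : 1 ≤ i) (hin : i < n)
    (hm : 1 ≤ m) (hm' : m ≤ n) {x : ℂ} (hx : InTriangle (l i) (l (i + 1)) (u m) x) :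
    x ∈ polygonInterior (chainPolygon n u l) := by
  rw [← chainVertex_lower (n := n) (u := u) (l := l) 0 hi (by omega),
    ← chainVertex_lower (n := n) (u := u) (l := l) 0 (j := i + 1) (by omega) hin,
    ← chainVertex_upper (n := n) (u := u) (l := l) 1 hm hm',
    show (n : ℤ) + (i + 1 : ℕ) - 1 + 2 * n * 0 = n + i - 1 + 2 * n * 0 + 1 by push_cast; ring] at hx
  exact h.isCyclicDoubleChain.inTriangle_subset_interior (c := 1) (by omega) (by omega) (by omega)
    (by omega) hx

/-- The upper chain is reflex: it bends towards the lower chain. -/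
lemma orient_upper_nonneg (h : IsDoubleChain n u l) {i j k : ℕ} (hi : 1 ≤ i) (hij : i < j)
    (hjk : j < k) (hk : k ≤ n) : 0 ≤ orient (u i) (u j) (u k) := by
  by_contra! hneg
  have h1 := h.orient_upper_pos (m := 1) (by omega : 1 ≤ j) hjk hk le_rfl (by omega)
  have h2 := h.orient_upper_pos (m := 1) hi (hij.trans hjk) hk le_rfl (by omega)
  have h3 := h.orient_upper_pos (m := 1) hi hij (by omega) le_rfl (by omega)
  refine h.nonconvex_upper i j k 1 hi hij hjk hk le_rfl (by omega)
    (convexIndependent_of_orient (s := -1) (by linarith) ?_ ?_ ?_)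
  · rw [orient_swap] at h1; linarith
  · rw [← orient_rotate, ← orient_rotate, orient_swap_right] at h2
    rw [← orient_rotate] 
    linarith
  · rw [orient_swap, ← orient_rotate, ← orient_rotate] at h3; linarith

lemma orient_lower_nonpos (h : IsDoubleChain n u l) {i j k : ℕ} (hi : 1 ≤ i) (hij : i < j)
    (hjk : j < k) (hk : k ≤ n) : orient (l i) (l j) (l k) ≤ 0 := by
  by_contra! hpos
  have h1 := h.orient_lower_pos (m := 1) (by omega : 1 ≤ j) hjk hk le_rfl (by omega)
  have h2 := h.orient_lower_pos (m := 1) hi (hij.trans hjk) hk le_rfl (by omega)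
  have h3 := h.orient_lower_pos (m := 1) hi hij (by omega) le_rfl (by omega)
  refine h.nonconvex_lower i j k 1 hi hij hjk hk le_rfl (by omega)
    (convexIndependent_of_orient (s := 1) (by linarith) (by linarith) ?_ ?_)
  · rw [orient_rotate]; linarith
  · rw [← orient_rotate]; linarith

end IsDoubleChain

/-! ### Triangulations of maximal degree at a vertex -/

/-- In a triangulation in which the degree of `a` is maximal, `a` is joined to every vertex it
sees: the edges and diagonals at `a` do not cross, so some triangulation contains all of them. -/
lemma IsMaxDegreeTriangulation.adj (hv : IsSimplePolygon v) {a b : ℂ} {T : SimpleGraph ℂ}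
    (hT : IsMaxDegreeTriangulation v a T) (hab : (visibilityGraph v).Adj a b) : T.Adj a b := by
  set G : SimpleGraph ℂ := visibilityGraph v ⊓ SimpleGraph.fromRel fun x _ => x = a with hG
  have hGnc : IsNonCrossing G := by
    have main : ∀ p q, (visibilityGraph v).Adj a p → (visibilityGraph v).Adj a q →
        s(a, q) ≠ s(a, p) → Disjoint (openSegment ℝ a p) (openSegment ℝ a q) := by
      intro p q hp hq hne
      rw [Set.disjoint_left]
      intro y hy hy'
      refine hne (eq_of_overlap hp.1 hy hy' (by simp) ?_ ?_ ?_ ?_)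
      · exact hv.notMem_openSegment hp (left_mem_range_of_adj hp)
      · exact hv.notMem_openSegment hp (right_mem_range_of_adj hq)
      · exact hv.notMem_openSegment hq (left_mem_range_of_adj hq)
      · exact hv.notMem_openSegment hq (right_mem_range_of_adj hp)
    have star : ∀ c d, G.Adj c d → ∃ p, (visibilityGraph v).Adj a p ∧ s(c, d) = s(a, p) ∧
        openSegment ℝ c d = openSegment ℝ a p := by
      rintro c d ⟨hcd, -, rfl | rfl⟩
      · exact ⟨d, hcd, rfl, rfl⟩
      · exact ⟨c, hcd.symm, Sym2.eq_swap, openSegment_symm ..⟩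
    intro c d e f hcd hef hne
    obtain ⟨p, hp, hs, ho⟩ := star c d hcd
    obtain ⟨q, hq, hs', ho'⟩ := star e f hef
    rw [ho, ho']
    exact main p q hp hq (by rw [← hs, ← hs']; exact hne.symm)
  have hedges : (visibilityGraph v).edgeSet.Finite := by
    refine (((finite_range v).prod (finite_range v)).image fun x => s(x.1, x.2)).subset ?_
    intro e he
    induction e with
    | _ x y => exact ⟨(x, y), ⟨left_mem_range_of_adj he, right_mem_range_of_adj he⟩, rfl⟩
  have hfin : {G : SimpleGraph ℂ | G ≤ visibilityGraph v ∧ IsNonCrossing G}.Finite := by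
    refine Set.Finite.of_finite_image (f := SimpleGraph.edgeSet)
      (hedges.finite_subsets.subset ?_) (SimpleGraph.edgeSet_injective.injOn)
    rintro _ ⟨H, hH, rfl⟩
    exact SimpleGraph.edgeSet_mono hH.1
  obtain ⟨T', hle, hT'⟩ := hfin.exists_le_maximal (a := G) ⟨inf_le_left, hGnc⟩
  have hT' : IsTriangulation v T' := hT'
  have hsub : T.neighborSet a ⊆ (visibilityGraph v).neighborSet a := fun x hx => hT.1.prop.1 hx
  have hsup : (visibilityGraph v).neighborSet a ⊆ T'.neighborSet a := fun x hx =>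
    hle ⟨hx, hx.1, Or.inl rfl⟩
  have hsub' : T'.neighborSet a ⊆ (visibilityGraph v).neighborSet a := fun x hx => hT'.prop.1 hx
  have hnfin : ((visibilityGraph v).neighborSet a).Finite :=
    (finite_range v).subset fun x hx => right_mem_range_of_adj hx
  have heq := Set.eq_of_subset_of_ncard_le hsub
    ((Set.ncard_le_ncard hsup (hnfin.subset hsub')).trans (hT.2 T' hT')) hnfin
  have : b ∈ T.neighborSet a := by rw [heq]; exact hab
  exact this

/-! ### Staircases -/

section Staircase

/-- The positions `(a, b)` of the edges between the two chains in a triangulation: a chain in the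
product order that starts at `(1, 1)` and proceeds by unit steps until it reaches an end of one of
the chains. -/
structure IsStaircase (n : ℕ) (E : ℕ → ℕ → Prop) : Prop where
  base : E 1 1
  chain : ∀ a b a' b', E a b → E a' b' → a < a' → b ≤ b'
  step : ∀ a b, E a b → a < n → b < n → E (a + 1) b ∨ E a (b + 1)

open Classical in
/-- The unit cells `(i, j)`, with corners `(i, j)` and `(i + 1, j + 1)`, that a staircase passes on
the side of the corner `(i, j + 1)`. -/
noncomputable def cells (n : ℕ) (E : ℕ → ℕ → Prop) : Finset (ℕ × ℕ) :=
  (Finset.Icc 1 (n - 1) ×ˢ Finset.Icc 1 (n - 1)).filter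
    fun c => ∃ a b, a ≤ c.1 ∧ c.2 < b ∧ E a b

variable {n : ℕ} {E E' : ℕ → ℕ → Prop}

/-- A staircase leaves the box `[1, i] × [1, j]` through its top or through its right side. -/
lemma IsStaircase.exists_exit (hE : IsStaircase n E) {i j : ℕ} (hi : 1 ≤ i) (hin : i < n)
    (hj : 1 ≤ j) (hjn : j < n) :
    (∃ a ≤ i, E a (j + 1)) ∨ ∃ b ≤ j, E (i + 1) b := by
  by_contra! hno
  have : ∀ m : ℕ, ∃ a b, E a b ∧ a ≤ i ∧ b ≤ j ∧ m ≤ a + b := by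
    intro m
    induction m with
    | zero => exact ⟨1, 1, hE.base, hi, hj, by omega⟩
    | succ m ih =>
      obtain ⟨a, b, hab, ha, hb, hm⟩ := ih
      rcases hE.step a b hab (by omega) (by omega) with h | h
      · refine ⟨a + 1, b, h, ?_, hb, by omega⟩
        by_contra hlt
        exact hno.2 b hb (by rwa [show i + 1 = a + 1 by omega])
      · refine ⟨a, b + 1, h, ha, ?_, by omega⟩
        by_contra hlt
        exact hno.1 a ha (by rwa [show j + 1 = b + 1 by omega])
  obtain ⟨a, b, -, ha, hb, hm⟩ := this (i + j + 1)
  omega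

/-- If two staircases differ by the exchange of one position `d` for another one `d'`, then at most
one cell changes from one side to the other. Indeed, the first staircase leaves the box of such a
cell `(i, j)` at a position `(a, j + 1)`, which must be `d`, and the second one leaves it at a
position `(i + 1, b)`, which must be `d'`. -/
lemma IsStaircase.card_cells_le (hE : IsStaircase n E) (hE' : IsStaircase n E') {α : Type*}
    (e : ℕ → ℕ → α) (d d' : α)
    (hd : ∀ a b, E a b → ¬ E' a b → e a b = d) (hd' : ∀ a b, E' a b → ¬ E a b → e a b = d')
    (he : ∀ a b a' b', E a b → E a' b' → e a b = e a' b' → b = b')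
    (he' : ∀ a b a' b', E' a b → E' a' b' → e a b = e a' b' → a = a') :
    (cells n E).card ≤ (cells n E').card + 1 := by
  classical
  have key : ∀ c ∈ cells n E \ cells n E', (∃ a, E a (c.2 + 1) ∧ e a (c.2 + 1) = d) ∧
      ∃ b, E' (c.1 + 1) b ∧ e (c.1 + 1) b = d' := by
    rintro ⟨i, j⟩ hc
    simp only [cells, Finset.mem_sdiff, Finset.mem_filter, Finset.mem_product, Finset.mem_Icc,
      not_and] at hc
    obtain ⟨⟨⟨⟨hi, hi'⟩, hj, hj'⟩, a₀, b₀, ha₀, hb₀, hE₀⟩, hnot⟩ := hc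
    have hnot := hnot ⟨⟨hi, hi'⟩, hj, hj'⟩
    rcases hE'.exists_exit hi (by omega) hj (by omega) with ⟨a, ha, h⟩ | ⟨b, hb, h⟩
    · exact absurd ⟨a, j + 1, ha, by omega, h⟩ hnot
    rcases hE.exists_exit hi (by omega) hj (by omega) with ⟨a, ha, h'⟩ | ⟨b', hb', h'⟩
    · refine ⟨⟨a, h', hd _ _ h' fun h'' => hnot ⟨a, j + 1, ha, by omega, h''⟩⟩,
        ⟨b, h, hd' _ _ h fun h'' => ?_⟩⟩
      have := hE.chain _ _ _ _ h' h'' (by omega)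
      omega
    · have := hE.chain _ _ _ _ hE₀ h' (by omega)
      omega
  have hcard : (cells n E \ cells n E').card ≤ 1 := by
    rw [Finset.card_le_one]
    rintro ⟨i, j⟩ hc ⟨i', j'⟩ hc'
    obtain ⟨⟨a, h1, h2⟩, b, h3, h4⟩ := key _ hc
    obtain ⟨⟨a', h1', h2'⟩, b', h3', h4'⟩ := key _ hc'
    have hj := he _ _ _ _ h1 h1' (h2.trans h2'.symm)
    have hi := he' _ _ _ _ h3 h3' (h4.trans h4'.symm)
    simp only [Prod.mk.injEq]
    omega
  have := Finset.card_le_card_sdiff_add_card (s := cells n E) (t := cells n E')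
  omega

lemma card_cells_eq (h : E 1 n) : (cells n E).card = (n - 1) ^ 2 := by
  classical
  rw [cells, Finset.filter_true_of_mem, Finset.card_product, Nat.card_Icc, sq]
  · simp
  · intro c hc
    simp only [Finset.mem_product, Finset.mem_Icc] at hc
    exact ⟨1, n, hc.1.1, by omega, h⟩

lemma IsStaircase.card_cells_eq_zero (hE : IsStaircase n E) (h : E n 1) :
    (cells n E).card = 0 := by
  classical
  rw [Finset.card_eq_zero, cells, Finset.filter_eq_empty_iff]
  rintro c hc ⟨a, b, ha, hb, hab⟩
  simp only [Finset.mem_product, Finset.mem_Icc] at hc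
  have := hE.chain _ _ _ _ hab h (by omega)
  omega

end Staircase

/-! ### A double chain on the boundary of a polygon -/

/-- If `w` lies to the right of `c i, b` and on the outer side of the edge `c i, c (i + 1)` of a
reflex chain `c`, and in none of the triangles `c k, c (k + 1), b`, then it has the
corresponding positions for all later edges of the chain. The factor `s = ± 1` allows for both
orientations of the chain. -/
lemma orient_propagate {c : ℕ → ℂ} {b w : ℂ} {s : ℝ} {i n : ℕ}
    (hb : ∀ k, i ≤ k → k < n → 0 < s * orient (c (k + 1)) (c k) b)
    (hreflex : ∀ k, i ≤ k → k + 1 < n → 0 ≤ s * orient (c k) (c (k + 1)) (c (k + 2)))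
    (hw : ∀ k, i ≤ k → k < n → 0 < s * orient (c k) b w → s * orient (c k) (c (k + 1)) w < 0 →
      0 < s * orient (c (k + 1)) b w)
    (h1 : 0 < s * orient (c i) b w) (h2 : s * orient (c i) (c (i + 1)) w < 0) :
    ∀ m, i + m < n → 0 < s * orient (c (i + m)) b w ∧
      s * orient (c (i + m)) (c (i + m + 1)) w < 0 := by
  intro m
  induction m with
  | zero => exact fun _ => ⟨h1, h2⟩
  | succ m ih =>
    intro hm
    obtain ⟨ih1, ih2⟩ := ih (by omega)
    have hnext := hw (i + m) (by omega) (by omega) ih1 ih2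
    refine ⟨hnext, ?_⟩
    have hr := hreflex (i + m) (by omega) (by omega)
    have hb1 := hb (i + m) (by omega) (by omega)
    have hb2 : 0 < s * orient (c (i + m + 2)) (c (i + m + 1)) b :=
      hb (i + m + 1) (by omega) (by omega)
    rw [show i + (m + 1) = i + m + 1 by omega, show i + m + 1 + 1 = i + m + 2 by omega]
    have e : s * orient (c (i + m + 1)) (c (i + m)) b *
        (s * orient (c (i + m + 1)) (c (i + m + 2)) w) =
        -(s * orient (c (i + m)) (c (i + m + 1)) (c (i + m + 2)) *
          (s * orient (c (i + m + 1)) b w)) +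
        s * orient (c (i + m)) (c (i + m + 1)) w *
          (s * orient (c (i + m + 2)) (c (i + m + 1)) b) := by
      simp only [orient]; ring
    by_contra! hge
    have h3 := mul_nonneg hb1.le hge
    have h4 := mul_nonneg hr hnext.le
    have h5 := mul_neg_of_neg_of_pos ih2 hb2
    linarith

/-- The double chain `u`, `l` is part of the boundary of the polygon `P`, whose interior contains
the one of the polygon of the double chain. -/
structure IsBoundaryChain (n : ℕ) (u l : ℕ → ℂ) {N : ℕ} (P : Fin N → ℂ) : Prop where
  doubleChain : IsDoubleChain n u l
  simple : IsSimplePolygon P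
  interior_subset : polygonInterior (chainPolygon n u l) ⊆ polygonInterior P
  visible_le : visibilityGraph (chainPolygon n u l) ≤ visibilityGraph P
  edge : ∀ (k : ℕ) (hk : k + 1 < 2 * n), ∃ i, P i = chainPolygon n u l ⟨k, by omega⟩ ∧
    P (finRotate N i) = chainPolygon n u l ⟨k + 1, hk⟩

namespace IsBoundaryChain

variable {n : ℕ} {u l : ℕ → ℂ} {N : ℕ} {P : Fin N → ℂ} {T : SimpleGraph ℂ}

lemma adj_upper (h : IsBoundaryChain n u l P) (hT : IsTriangulation P T) {i : ℕ} (hi : 1 ≤ i)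
    (hin : i < n) : T.Adj (u i) (u (i + 1)) := by
  obtain ⟨k, hk, hk'⟩ := h.edge (n - (i + 1)) (by omega)
  have := hT.adj_edge h.simple k
  rw [hk, hk'] at this
  simp only [chainPolygon] at this
  rw [if_pos (by omega), if_pos (by omega), show n - (n - (i + 1)) = i + 1 by omega,
    show n - (n - (i + 1) + 1) = i by omega] at this
  exact this.symm

lemma adj_lower (h : IsBoundaryChain n u l P) (hT : IsTriangulation P T) {j : ℕ} (hj : 1 ≤ j)
    (hjn : j < n) : T.Adj (l j) (l (j + 1)) := by
  obtain ⟨k, hk, hk'⟩ := h.edge (n + j - 1) (by omega)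
  have := hT.adj_edge h.simple k
  rw [hk, hk'] at this
  simp only [chainPolygon] at this
  rw [if_neg (by omega), if_neg (by omega), show n + j - 1 - n + 1 = j by omega,
    show n + j - 1 + 1 - n + 1 = j + 1 by omega] at this
  exact this

lemma adj_one (h : IsBoundaryChain n u l P) (hT : IsTriangulation P T) : T.Adj (u 1) (l 1) := by
  have hn := h.doubleChain.two_le
  obtain ⟨k, hk, hk'⟩ := h.edge (n - 1) (by omega)
  have := hT.adj_edge h.simple k
  rw [hk, hk'] at this
  simp only [chainPolygon] at this
  rw [if_pos (by omega), if_neg (by omega), show n - (n - 1) = 1 by omega,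
    show n - 1 + 1 - n + 1 = 1 by omega] at this
  exact this

lemma sees (h : IsBoundaryChain n u l P) {i j : ℕ} (hi : 1 ≤ i) (hin : i ≤ n) (hj : 1 ≤ j)
    (hjn : j ≤ n) : (visibilityGraph P).Adj (u i) (l j) :=
  h.visible_le (h.doubleChain.sees i ⟨hi, hin⟩ j ⟨hj, hjn⟩)

/-- Two edges between the chains do not cross. -/
lemma not_adj_of_crossing (h : IsBoundaryChain n u l P) (hT : IsTriangulation P T)
    {i j i' j' : ℕ} (hi : 1 ≤ i) (hii : i < i') (hin : i' ≤ n) (hj : 1 ≤ j') (hjj : j' < j)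
    (hjn : j ≤ n) (h1 : T.Adj (u i) (l j)) : ¬ T.Adj (u i') (l j') := by
  intro h2
  have o1 := h.doubleChain.orient_upper_pos hi hii hin hj (by omega)
  have o2 := h.doubleChain.orient_upper_pos hi hii hin (by omega : 1 ≤ j) hjn
  have o3 := h.doubleChain.orient_lower_pos hj hjj hjn (by omega : 1 ≤ i') hin
  have o4 := h.doubleChain.orient_lower_pos hj hjj hjn hi (by omega)
  obtain ⟨x, hx, hx'⟩ := exists_mem_openSegment_of_orient o1 o2 o3 o4
  refine Set.disjoint_left.1 (hT.prop.2 _ _ _ _ h2 h1 ?_) hx hx'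
  intro hs
  rcases Sym2.eq_iff.1 hs with ⟨he, -⟩ | ⟨he, he'⟩
  · rw [he] at o1; simp at o1
  · rw [he'] at o1; simp at o1

/-- The triangle of a triangulation to the right of an edge `u i, l j` has the third vertex
`u (i + 1)` or `l (j + 1)`; otherwise this vertex would lie in the interior of the hourglass. -/
lemma adj_succ_or_adj_succ (h : IsBoundaryChain n u l P) (hT : IsTriangulation P T)
    (hno : ¬ HasHourglassTriangle n u l T) {i j : ℕ} (hi : 1 ≤ i) (hin : i < n) (hj : 1 ≤ j)
    (hjn : j < n) (hij : T.Adj (u i) (l j)) :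
    T.Adj (u (i + 1)) (l j) ∨ T.Adj (u i) (l (j + 1)) := by
  have hD := h.doubleChain
  have vis := fun {c d} (hcd : T.Adj c d) => hT.prop.1 hcd
  have had := h.adj_upper hT hi hin
  have hbe := h.adj_lower hT hj hjn
  have hDu := hD.orient_upper_pos hi (Nat.lt_succ_self i) hin hj hjn.le
  have hDl := hD.orient_lower_pos hj (Nat.lt_succ_self j) hjn hi hin.le
  have hDu' : 0 < orient (u i) (l j) (u (i + 1)) := by rw [orient_rotate]; exact hDu
  obtain ⟨w, haw, hbw, hw1, hw2, hempty⟩ := hT.exists_triangle h.simple hij had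
    hDu' (fun x hx => h.interior_subset
      (hD.inTriangle_upper hi hin hj hjn.le hx.rotate.rotate))
  by_contra! hnot
  have hwd : w ≠ u (i + 1) := by rintro rfl; exact hnot.1 hbw.symm
  have hwe : w ≠ l (j + 1) := by rintro rfl; exact hnot.2 haw
  have hwV := right_mem_range_of_adj (vis haw)
  have hw3 : orient (u i) (u (i + 1)) w < 0 := by
    rw [orient_swap]
    refine neg_lt_zero.2 (lt_of_le_of_ne hw2 fun h0 => ?_)
    rcases between_of_orient_eq_zero had.ne.symm hwd.symm haw.ne h0.symm with hh | hh | hh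
    · exact h.simple.notMem_openSegment (vis had.symm) hwV hh
    · exact h.simple.notMem_openSegment (vis haw) (right_mem_range_of_adj (vis had)) hh
    · have := orient_pos_of_mem_openSegment hh hw1 hDu'.le
      simp at this
  have hw4 : 0 < orient (l j) (l (j + 1)) w := by
    by_contra! hle
    have hαe : 0 < orient (u i) (l j) (l (j + 1)) := by rwa [← orient_rotate]
    have hβe : 0 ≤ orient (l j) w (l (j + 1)) := by rw [orient_swap_right]; linarith
    have hγe : orient w (u i) (l (j + 1)) < 0 := by
      by_contra! hγe
      rcases hempty _ (right_mem_range_of_adj (vis hbe)) hαe.le hβe hγe with he | he | he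
      · rw [he] at hαe; simp at hαe
      · rw [he] at hαe; simp at hαe
      · exact hwe he.symm
    obtain ⟨x, hx, hx0⟩ := exists_zero_mem_openSegment (continuous_orient w (u i))
      (x := l j) (y := l (j + 1)) (by rwa [← orient_rotate]) hγe
    have hxα : 0 < orient (u i) (l j) x := orient_pos_of_mem_openSegment' hx (by simp) hαe
    have hxβ : 0 ≤ orient (l j) w x := orient_nonneg_of_mem_segment
      (openSegment_subset_segment ℝ _ _ hx) (by simp) hβe
    have hxs := mem_segment_of_orient (by rwa [← orient_rotate]) hx0 hxα.le hxβ
    have hxw : w ≠ x := by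
      rintro rfl
      exact h.simple.notMem_openSegment (vis hbe) hwV hx
    have hxa : u i ≠ x := by rintro rfl; simp at hxα
    refine Set.disjoint_left.1 (hT.prop.2 _ _ _ _ hbe haw.symm ?_) hx
      (mem_openSegment_of_ne_left_right hxw hxa hxs)
    intro hs
    rcases Sym2.eq_iff.1 hs with ⟨he, -⟩ | ⟨he, -⟩
    · exact hbw.ne he
    · exact hij.ne he.symm
  have hu := orient_propagate (c := u) (b := l j) (w := w) (s := 1) (i := i) (n := n)
    (fun k hk hkn => by
      simpa using hD.orient_upper_pos (by omega) (Nat.lt_succ_self k) hkn hj hjn.le)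
    (fun k hk hkn => by
      simpa using hD.orient_upper_nonneg (by omega) (Nat.lt_succ_self k)
        (Nat.lt_succ_self (k + 1)) hkn)
    (fun k hk hkn h1 h2 => by
      simp only [one_mul] at h1 h2 ⊢
      by_contra! h3
      rw [orient_swap] at h2 h3
      rcases h.simple.eq_corner (a := u (k + 1)) (b := u k) (c := l j)
        (vis (h.adj_upper hT (by omega) hkn).symm) (h.sees (by omega) hkn.le hj hjn.le)
        (h.sees (by omega) hkn hj hjn.le).symm
        (hD.orient_upper_pos (by omega) (Nat.lt_succ_self k) hkn hj hjn.le)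
        (fun x hx => h.interior_subset (hD.inTriangle_upper (by omega) hkn hj hjn.le hx))
        hwV (by linarith) h1.le (by linarith) with he | he | he
      · rw [he] at h2; simp at h2
      · rw [he] at h1; simp at h1
      · rw [he] at h1; simp at h1)
    (by simpa using hw1) (by simpa using hw3) (n - 1 - i) (by omega)
  have hl := orient_propagate (c := l) (b := u i) (w := w) (s := -1) (i := j) (n := n)
    (fun k hk hkn => by
      have := hD.orient_lower_pos (by omega : 1 ≤ k) (Nat.lt_succ_self k) hkn hi hin.le
      rw [orient_swap]; linarith)
    (fun k hk hkn => by
      have := hD.orient_lower_nonpos (by omega : 1 ≤ k) (Nat.lt_succ_self k)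
        (Nat.lt_succ_self (k + 1)) hkn
      simpa using this)
    (fun k hk hkn h1 h2 => by
      have e1 := orient_swap (u i) (l k) w
      by_contra! h3
      rcases h.simple.eq_corner (a := l k) (b := l (k + 1)) (c := u i)
        (vis (h.adj_lower hT (by omega) hkn)) (h.sees hi hin.le (by omega) hkn).symm
        (h.sees hi hin.le (by omega) hkn.le)
        (hD.orient_lower_pos (by omega) (Nat.lt_succ_self k) hkn hi hin.le)
        (fun x hx => h.interior_subset (hD.inTriangle_lower (by omega) hkn hi hin.le hx))
        hwV (by linarith) (by linarith) (by linarith) with he | he | he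
      · rw [he] at h1; simp at h1
      · rw [he] at h2; simp at h2
      · rw [he] at h1; simp at h1)
    (by rw [orient_swap]; linarith) (by linarith) (n - 1 - j) (by omega)
  rw [show i + (n - 1 - i) = n - 1 by omega, show n - 1 + 1 = n by omega] at hu
  rw [show j + (n - 1 - j) = n - 1 by omega, show n - 1 + 1 = n by omega] at hl
  refine hno ⟨i, ⟨hi, hin.le⟩, j, ⟨hj, hjn.le⟩, w, ?_, hij, haw, hbw⟩
  refine mem_interior.2 ⟨{x | orient (u (n - 1)) (u n) x < 0} ∩ {x | 0 < orient (l (n - 1)) (l n) x},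
    fun x hx => Or.inr ⟨le_of_lt hx.1, le_of_lt hx.2⟩, ?_, ?_, ?_⟩
  · exact (isOpen_lt (continuous_orient _ _) continuous_const).inter
      (isOpen_lt continuous_const (continuous_orient _ _))
  · simpa using hu.2
  · simpa using hl.2

lemma isStaircase (h : IsBoundaryChain n u l P) (hT : IsTriangulation P T)
    (hno : ¬ HasHourglassTriangle n u l T) :
    IsStaircase n fun a b => (1 ≤ a ∧ a ≤ n ∧ 1 ≤ b ∧ b ≤ n) ∧ T.Adj (u a) (l b) := by
  have hn := h.doubleChain.two_le
  refine ⟨⟨by omega, h.adj_one hT⟩, ?_, ?_⟩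
  · rintro a b a' b' ⟨hr, hab⟩ ⟨hr', hab'⟩ haa
    by_contra! hbb
    exact h.not_adj_of_crossing hT hr.1 haa hr'.2.1 hr'.2.2.1 hbb hr.2.2.2 hab hab'
  · rintro a b ⟨hr, hab⟩ ha hb
    rcases h.adj_succ_or_adj_succ hT hno hr.1 ha hr.2.2.1 hb hab with h' | h'
    · exact Or.inl ⟨by omega, h'⟩
    · exact Or.inr ⟨by omega, h'⟩

end IsBoundaryChain

lemma IsDoubleChain.upper_injective {n : ℕ} {u l : ℕ → ℂ} (h : IsDoubleChain n u l) {i j : ℕ}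
    (hi : 1 ≤ i ∧ i ≤ n) (hj : 1 ≤ j ∧ j ≤ n) (he : u i = u j) : i = j := by
  have hn := h.two_le
  by_contra hne
  rcases lt_or_gt_of_ne hne with hlt | hlt
  · have := h.orient_upper_pos hi.1 hlt hj.2 le_rfl (by omega)
    rw [he] at this; simp at this
  · have := h.orient_upper_pos hj.1 hlt hi.2 le_rfl (by omega)
    rw [he] at this; simp at this

lemma IsDoubleChain.lower_injective {n : ℕ} {u l : ℕ → ℂ} (h : IsDoubleChain n u l) {i j : ℕ}
    (hi : 1 ≤ i ∧ i ≤ n) (hj : 1 ≤ j ∧ j ≤ n) (he : l i = l j) : i = j := by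
  have hn := h.two_le
  by_contra hne
  rcases lt_or_gt_of_ne hne with hlt | hlt
  · have := h.orient_lower_pos hi.1 hlt hj.2 le_rfl (by omega)
    rw [he] at this; simp at this
  · have := h.orient_lower_pos hj.1 hlt hi.2 le_rfl (by omega)
    rw [he] at this; simp at this

/-- The lower bound for flip sequences between triangulations that contain the edges `u 1, l n` and
`u n, l 1`, respectively. -/
lemma IsBoundaryChain.sq_le {n : ℕ} {u l : ℕ → ℂ} {N : ℕ} {P : Fin N → ℂ}
    (hB : IsBoundaryChain n u l P) {m : ℕ} {σ : ℕ → SimpleGraph ℂ} (hσ : IsFlipSequence P m σ)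
    (hstart : (σ 0).Adj (u 1) (l n)) (hend : (σ m).Adj (u n) (l 1))
    (hempty : ∀ t ≤ m, ¬ HasHourglassTriangle n u l (σ t)) : (n - 1) ^ 2 ≤ m := by
  have hD := hB.doubleChain
  have hn := hD.two_le
  set E : ℕ → ℕ → ℕ → Prop := fun t a b =>
    (1 ≤ a ∧ a ≤ n ∧ 1 ≤ b ∧ b ≤ n) ∧ (σ t).Adj (u a) (l b) with hE
  have hstair : ∀ t ≤ m, IsStaircase n (E t) := fun t ht =>
    hB.isStaircase (hσ.1 t ht) (hempty t ht)
  have hne : ∀ a b, 1 ≤ a ∧ a ≤ n → 1 ≤ b ∧ b ≤ n → u a ≠ l b := fun a b ha hb =>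
    (hD.sees a ha b hb).ne
  have hflip : ∀ t < m, (cells n (E t)).card ≤ (cells n (E (t + 1))).card + 1 := by
    intro t ht
    obtain ⟨d, -, d', -, hdd⟩ := hσ.2 t ht
    have hmem : ∀ x y, (σ (t + 1)).Adj x y ↔ s(x, y) = d' ∨ ((σ t).Adj x y ∧ s(x, y) ≠ d) := by
      intro x y
      rw [← SimpleGraph.mem_edgeSet, hdd]
      simp
    refine (hstair t ht.le).card_cells_le (hstair (t + 1) ht) (fun a b => s(u a, l b)) d d'
      ?_ ?_ ?_ ?_
    · rintro a b ⟨hr, hab⟩ hnot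
      by_contra hd
      exact hnot ⟨hr, (hmem _ _).2 (Or.inr ⟨hab, hd⟩)⟩
    · rintro a b ⟨hr, hab⟩ hnot
      rcases (hmem _ _).1 hab with h | h
      · exact h
      · exact absurd ⟨hr, h.1⟩ hnot
    · rintro a b a' b' ⟨hr, -⟩ ⟨hr', -⟩ he
      rcases Sym2.eq_iff.1 he with ⟨-, h⟩ | ⟨h, -⟩
      · exact hD.lower_injective hr.2.2 hr'.2.2 h
      · exact absurd h (hne _ _ ⟨hr.1, hr.2.1⟩ hr'.2.2)
    · rintro a b a' b' ⟨hr, -⟩ ⟨hr', -⟩ he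
      rcases Sym2.eq_iff.1 he with ⟨h, -⟩ | ⟨h, -⟩
      · exact hD.upper_injective ⟨hr.1, hr.2.1⟩ ⟨hr'.1, hr'.2.1⟩ h
      · exact absurd h (hne _ _ ⟨hr.1, hr.2.1⟩ hr'.2.2)
  have hcount : ∀ t ≤ m, (cells n (E 0)).card ≤ (cells n (E t)).card + t := by
    intro t
    induction t with
    | zero => simp
    | succ t ih =>
      intro ht
      have := ih (by omega)
      have := hflip t ht
      omega
  have h0 : (cells n (E 0)).card = (n - 1) ^ 2 := card_cells_eq ⟨by omega, hstart⟩
  have hm : (cells n (E m)).card = 0 :=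
    (hstair m le_rfl).card_cells_eq_zero ⟨by omega, hend⟩
  have := hcount m le_rfl
  omega

end FlipDist

theorem mainTheorem5 (n : ℕ) (u l : ℕ → ℂ) (hD : FlipDist.IsDoubleChain n u l)
    {N : ℕ} (P : Fin N → ℂ) (hP : FlipDist.IsSimplePolygon P)
    (hsub : FlipDist.polygonRegion (FlipDist.chainPolygon n u l) ⊆ FlipDist.polygonRegion P)
    (hbdry : ∃ s : Fin N, ∀ k : Fin (2 * n),
      P ((finRotate N)^[k.val] s) = FlipDist.chainPolygon n u l k)
    (Tu Tl : SimpleGraph ℂ)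
    (hTu : FlipDist.IsUpperExtreme n u l Tu) (hTl : FlipDist.IsLowerExtreme n u l Tl)
    (m : ℕ) (σ : ℕ → SimpleGraph ℂ) (hσ : FlipDist.IsFlipSequence P m σ)
    (hstart : Tu ≤ σ 0) (hend : Tl ≤ σ m)
    (hempty : ∀ t ≤ m, ¬ FlipDist.HasHourglassTriangle n u l (σ t)) :
    (n - 1) ^ 2 ≤ m := by
  have hn := hD.two_le
  have hint := hP.polygonInterior_subset hsub
  obtain ⟨s, hs⟩ := hbdry
  have hB : FlipDist.IsBoundaryChain n u l P := by
    refine ⟨hD, hP, hint, ?_, ?_⟩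
    · rintro a b ⟨hab, ⟨i, hi⟩ | ⟨ha, hb, hdiag⟩⟩
      · -- The edge `l n, u n` need not be an edge of `P`, but, like all edges of the polygon of the
        -- double chain, it belongs to `Tu` and so to the triangulation `σ 0` of `P`.
        have := (hσ.1 0 (Nat.zero_le m)).prop.1 (hstart (hTu.1.adj_edge hD.simple i))
        rcases Sym2.eq_iff.1 hi with ⟨rfl, rfl⟩ | ⟨rfl, rfl⟩
        · exact this
        · exact this.symm
      · have hr : Set.range (FlipDist.chainPolygon n u l) ⊆ Set.range P := by
          rintro _ ⟨k, rfl⟩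
          exact ⟨_, hs k⟩
        exact ⟨hab, Or.inr ⟨hr ha, hr hb, hdiag.trans hint⟩⟩
    · intro k hk
      refine ⟨(finRotate N)^[k] s, hs ⟨k, by omega⟩, ?_⟩
      rw [← Function.iterate_succ_apply' (finRotate N) k s]
      exact hs ⟨k + 1, hk⟩
  refine hB.sq_le hσ (hstart (hTu.adj hD.simple ?_)) (hend (hTl.adj hD.simple ?_)).symm hempty
  · exact hD.sees 1 ⟨le_rfl, by omega⟩ n ⟨by omega, le_rfl⟩
  · exact (hD.sees n ⟨by omega, le_rfl⟩ 1 ⟨le_rfl, by omega⟩).symm
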